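/- Let $\tau:[0,1]\to[0,1]$ be a bijective (Borel) transformation that is ergodic, in particular measure preserving, for Lebesgue measure. Let $v$ be a generalized polynomial on $[0,1]$, that is, \[ v(x)=C\prod_{i=0}^{l}\bigl(\sigma_i(x-x_i)\bigr)^{s_i},\qquad x\in[0,1], \] where $l\ge 0$, $C\neq 0$ is a constant, $s_i>0$ are real numbers, $x_i\in[0,1]$, and each $\sigma_i$ is either $\sigma_i(t)=t$ or $\sigma_i(t)=|t|$; it is understood that all the powers are defined as real numbers on $[0,1]$ (the power $y^s$ of a number $y<0$ is defined when $s=a/b$ with integers $a\ge 1$ and $b\ge 1$, $b$ odd, and is then the real $b$-th root of $y^a$). For $N\ge 1$ let \[ D_N=\sup_{x\in[0,1)}\ \sup_{0\le\alpha<\beta\le 1}\left|\frac{\#\{n:\ 1\le n\le N,\ \tau^n(x)\in[\alpha,\beta)\}}{N}-(\beta-\alpha)\right| \] be the discrepancy of $(\tau^n)_{n\ge1}$. Assume that, for some $\varepsilon>0$, \[ D_n=O\left(\frac{1}{\ln^{3+\varepsilon}n}\right)\quad (n\to\infty). \] Then, for every $1\le p\le\infty$, $Tf(x)=v(x)f(\tau(x))$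 defines a bounded linear operator $T$ on the complex space $L^p([0,1])$ which has a nontrivial closed hyperinvariant subspace: there is a closed linear subspace $M$ of $L^p([0,1])$ with $\{0\}\ne M\ne L^p([0,1])$ such that $SM\subseteq M$ for every bounded linear operator $S$ on $L^p([0,1])$ with $ST=TS$. -/

import Mathlib

open MeasureTheory Set
open scoped ENNReal

/-- The number of indices `1 ≤ n ≤ N` with `ω n ∈ E`. -/
noncomputable def countIn (N : ℕ) (E : Set ℝ) (ω : ℕ → ℝ) : ℕ :=
  open Classical in ((Finset.Icc 1 N).filter (fun n => ω n ∈ E)).card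

/-- The discrepancy `D_N(ω)` of the sequence `ω 1, ω 2, …` of points of `[0,1]`: the supremum over
`0 ≤ α < β ≤ 1` of `|A(N, [α, β), ω) / N - (β - α)|`. -/
noncomputable def seqDiscrepancy (N : ℕ) (ω : ℕ → ℝ) : ℝ :=
  sSup {d : ℝ | ∃ α β : ℝ, 0 ≤ α ∧ α < β ∧ β ≤ 1 ∧
    d = |(countIn N (Ico α β) ω : ℝ) / N - (β - α)|}

/-- The discrepancy `D_N` of a transformation `τ` of `[0,1]`: the supremum over the starting points
`x ∈ [0,1)` of the discrepancy of the orbit `(τ^n x)_{n ≥ 1}`. -/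
noncomputable def mapDiscrepancy (τ : unitInterval → unitInterval) (N : ℕ) : ℝ :=
  sSup {d : ℝ | ∃ x : unitInterval, (x : ℝ) < 1 ∧
    d = seqDiscrepancy N (fun n => ((τ^[n] x : unitInterval) : ℝ))}

/-- `z` is the value of the real power `y ^ s` (for `s > 0`), whenever that power is defined: either
`y ≥ 0`, or `s = a / b` is a rational number with odd denominator `b`, and then `z` is the real
`b`-th root of `y ^ a`. On `y ≥ 0` the two clauses give the same value. -/
def IsRealPower (y s z : ℝ) : Prop :=
  (0 ≤ y ∧ z = y ^ s) ∨ ∃ a b : ℕ, Odd b ∧ s = (a : ℝ) / b ∧ z ^ b = y ^ a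

/-- Generalized polynomials on `[0,1]`: functions `v x = C * ∏ i, (σ i (x - x_i)) ^ (s i)` over
`i = 0, …, l`, where `C ≠ 0`, `s i > 0`, `x_i ∈ [0,1]`, each `σ i` is the identity or the absolute
value, and all the powers that occur are defined (`g i x` is the `i`-th factor at `x`). -/
def IsGeneralizedPolynomial (v : unitInterval → ℂ) : Prop :=
  ∃ (l : ℕ) (C : ℂ) (s : Fin (l + 1) → ℝ) (c : Fin (l + 1) → unitInterval)
    (σ : Fin (l + 1) → ℝ → ℝ) (g : Fin (l + 1) → unitInterval → ℝ),
    C ≠ 0 ∧ (∀ i, 0 < s i) ∧ (∀ i, (σ i = fun t => t) ∨ (σ i = fun t => |t|)) ∧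
    (∀ (i) (x : unitInterval), IsRealPower (σ i ((x : ℝ) - (c i : ℝ))) (s i) (g i x)) ∧
    ∀ x, v x = C * ∏ i, (g i x : ℂ)

/-- `T` is the weighted composition operator `f ↦ v · (f ∘ τ)` on `L^p([0,1])`. This determines `T`,
as elements of `L^p` that agree almost everywhere are equal. -/
def IsWeightedComposition (p : ℝ≥0∞) [Fact (1 ≤ p)] (v : unitInterval → ℂ)
    (τ : unitInterval → unitInterval)
    (T : Lp ℂ p (volume : Measure unitInterval) →L[ℂ] Lp ℂ p (volume : Measure unitInterval)) :
    Prop :=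
  ∀ f : Lp ℂ p (volume : Measure unitInterval),
    (T f : unitInterval → ℂ) =ᵐ[volume] fun x => v x * (f : unitInterval → ℂ) (τ x)

/-- `T` has a nontrivial closed hyperinvariant subspace: a closed subspace, neither zero nor the
whole space, that is mapped into itself by every bounded operator commuting with `T`. -/
def HasNontrivialHyperinvariantSubspace {E : Type*} [NormedAddCommGroup E] [NormedSpace ℂ E]
    (T : E →L[ℂ] E) : Prop :=
  ∃ M : Submodule ℂ E, IsClosed (M : Set E) ∧ M ≠ ⊥ ∧ M ≠ ⊤ ∧
    ∀ S : E →L[ℂ] E, Commute S T → ∀ f ∈ M, S f ∈ M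

/-! ### An operator-theoretic criterion: formal two-sided orbits and a vanishing convolution. -/

section Abstract

variable {E : Type*} [NormedAddCommGroup E] [NormedSpace ℂ E]

/-! This is a Beurling–Wermer type argument. Suppose `X n` and `Y n` are two-sided orbits, up to the
scalar `r`, of `T` and of its adjoint. For `S` commuting with `T`, the number `Y m (S (X n))`
depends only on `m + n`. Hence with `x = ∑ a n • X n` and `y = ∑ b n • Y n`, the value `y (S x)`
only involves the convolution of `a` and `b`. If that convolution is zero, `y` annihilates the whole
commutant orbit of `x`, and the vectors `z` with `y (S z) = 0` for all such `S` form a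
hyperinvariant subspace.

Nonzero `a`, `b` with zero convolution are Fourier coefficients of functions with disjoint supports:
take a function supported near `0` modulo `1` and its translate by `1/2`. The coefficients must also
beat the growth of the orbits. If `ρ n` bounds `‖X n‖` and `‖Y n‖`, this is possible when `log (ρ
n)` is at most `H m` for `2 ^ m ≤ |n| < 2 ^ (m + 1)`, with `∑ H m / 2 ^ m` finite, a
non-quasianalyticity condition (`exists_convolution_eq_zero_of_summable`).

The orbits start from the indicator of a set `A` and are weighted by products of `v` along orbits of
`τ`, normalised by the geometric mean of `|v|`. The logarithms of these products are deviations of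
Birkhoff sums of `log |v|`. A Koksma-type estimate with truncated logarithmic singularities bounds
them by about `N * D_N * log N` (`abs_sum_log_max_sub_le`), as long as the orbit approaches the
zeros of `v` at most quadratically in time; a Borel–Cantelli count gives a set of positive measure
on which it does. So the hypothesis on `D_N` yields a bound of order `N / log² N`, and the dyadic
sums behave like `∑ 1 / m²`.

Finally `A` is shrunk until it is disjoint from finitely many of its images. Then the term `n = 0`
dominates the pairings, so neither `x` nor `y` degenerates. Such sets exist because vanishing
discrepancy excludes periodic points other than possibly the endpoint `1`. -/

theorem pairing_shift (T S : E →L[ℂ] E) (hS : Commute S T) {r : ℂ} (hr : r ≠ 0)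
    (X : ℤ → E) (Y : ℤ → E →L[ℂ] ℂ) (hX : ∀ n, T (X n) = r • X (n + 1))
    (hY : ∀ n x, Y n (T x) = r * Y (n + 1) x) (m n : ℤ) :
    Y m (S (X n)) = Y 0 (S (X (n + m))) := by
  have step : ∀ m n, Y (m + 1) (S (X n)) = Y m (S (X (n + 1))) := by
    intro m n
    have h1 := hY m (S (X n))
    have h2 : T (S (X n)) = S (T (X n)) := by
      have := congrArg (fun U : E →L[ℂ] E => U (X n)) hS.eq
      simpa using this.symm
    rw [h2, hX, map_smul, map_smul, smul_eq_mul] at h1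
    exact (mul_left_cancel₀ hr h1).symm
  induction m using Int.induction_on generalizing n with
  | zero => simp
  | succ i ih => rw [step, ih]; congr 3; ring
  | pred i ih =>
    have h := step (-(i : ℤ) - 1) (n - 1)
    rw [sub_add_cancel, sub_add_cancel, ih] at h
    rw [← h]; congr 3; ring

/-- The last two conditions make the subspace nontrivial: the first says that `Y 0` does not vanish
at `x`, so `x ≠ 0`; the second, after shifting indices, says that `y` does not vanish at `X 0`. -/
theorem hasNontrivialHyperinvariantSubspace_of_convolution_eq_zero [CompleteSpace E]
    (T : E →L[ℂ] E) {r : ℂ} (hr : r ≠ 0)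
    (X : ℤ → E) (Y : ℤ → E →L[ℂ] ℂ) (hX : ∀ n, T (X n) = r • X (n + 1))
    (hY : ∀ n x, Y n (T x) = r * Y (n + 1) x) (a b : ℤ → ℂ)
    (ha : Summable fun n => ‖a n‖ * ‖X n‖) (hb : Summable fun n => ‖b n‖ * ‖Y n‖)
    (hab : ∀ k, ∑' n, a n * b (k - n) = 0)
    (hax : ∑' n, a n * Y 0 (X n) ≠ 0) (hbx : ∑' n, b n * Y 0 (X n) ≠ 0) :
    HasNontrivialHyperinvariantSubspace T := by
  have hxs : Summable fun n => a n • X n :=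
    Summable.of_norm (by simpa [norm_smul] using ha)
  have hys : Summable fun n => b n • Y n :=
    Summable.of_norm (by simpa [norm_smul] using hb)
  set x : E := ∑' n, a n • X n with hx
  set y : E →L[ℂ] ℂ := ∑' n, b n • Y n with hy
  have hLx : ∀ L : E →L[ℂ] ℂ, L x = ∑' n, a n * L (X n) := by
    intro L
    rw [hx, L.map_tsum hxs]
    simp
  have hyz : ∀ z, y z = ∑' n, b n * Y n z := by
    intro z
    have := (ContinuousLinearMap.apply ℂ ℂ z).map_tsum hys
    simpa using this
  have key : ∀ S : E →L[ℂ] E, Commute S T → y (S x) = 0 := by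
    intro S hS
    have hsum : Summable fun q : ℤ × ℤ => (b q.2 * a q.1) * Y 0 (S (X (q.1 + q.2))) := by
      have h1 : Summable fun q : ℤ × ℤ => (‖a q.1‖ * ‖X q.1‖) * (‖b q.2‖ * ‖Y q.2‖) :=
        ha.mul_of_nonneg hb (fun _ => by positivity) (fun _ => by positivity)
      refine Summable.of_norm_bounded (h1.mul_left ‖S‖) ?_
      rintro ⟨n, m⟩
      simp only
      rw [← pairing_shift T S hS hr X Y hX hY, norm_mul, norm_mul]
      calc ‖b m‖ * ‖a n‖ * ‖Y m (S (X n))‖ ≤ ‖b m‖ * ‖a n‖ * (‖Y m‖ * (‖S‖ * ‖X n‖)) := by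
            gcongr
            exact ((Y m).le_opNorm _).trans (by gcongr; exact S.le_opNorm _)
        _ = _ := by ring
    have e1 : y (S x) = ∑' m, ∑' n, (b m * a n) * Y 0 (S (X (n + m))) := by
      rw [hyz]
      refine tsum_congr fun m => ?_
      rw [show Y m (S x) = ((Y m).comp S) x from rfl, hLx, ← tsum_mul_left]
      refine tsum_congr fun n => ?_
      rw [ContinuousLinearMap.comp_apply, pairing_shift T S hS hr X Y hX hY]
      ring
    have hsum' := (Equiv.prodComm ℤ ℤ).summable_iff.2 hsum
    have e2 : y (S x) = ∑' q : ℤ × ℤ, (b q.2 * a q.1) * Y 0 (S (X (q.1 + q.2))) := by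
      rw [e1, ← (Equiv.prodComm ℤ ℤ).tsum_eq
        (fun q : ℤ × ℤ => (b q.2 * a q.1) * Y 0 (S (X (q.1 + q.2))))]
      exact (hsum'.tsum_prod' fun m => hsum'.prod_factor m).symm
    rw [e2]
    -- Regroup the absolutely convergent double sum by `k = n + m`; the inner sums become the
    -- convolution at `k`.
    let ε : ℤ × ℤ ≃ ℤ × ℤ :=
      { toFun := fun q => (q.2, q.1 - q.2)
        invFun := fun q => (q.1 + q.2, q.1)
        left_inv := fun q => by ext <;> simp
        right_inv := fun q => by ext <;> simp }
    have hsum2 := ε.summable_iff.2 hsum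
    rw [← ε.tsum_eq]
    refine (hsum2.tsum_prod' fun m => hsum2.prod_factor m).trans ?_
    simp only [Function.comp_apply]
    have : ∀ k n : ℤ, (b (ε (k, n)).2 * a (ε (k, n)).1) *
        Y 0 (S (X ((ε (k, n)).1 + (ε (k, n)).2))) = a n * b (k - n) * Y 0 (S (X k)) := by
      intro k n
      simp only [ε, Equiv.coe_fn_mk, add_sub_cancel]
      ring
    simp_rw [this, tsum_mul_right, hab]
    simp
  let M : Submodule ℂ E := ⨅ S : {S : E →L[ℂ] E // Commute S T}, LinearMap.ker (y.comp S.1 : E →ₗ[ℂ] ℂ)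
  have hM : ∀ z, z ∈ M ↔ ∀ S : E →L[ℂ] E, Commute S T → y (S z) = 0 := by
    intro z
    simp [M, Submodule.mem_iInf]
  refine ⟨M, ?_, ?_, ?_, ?_⟩
  · have : (M : Set E) = ⋂ S : {S : E →L[ℂ] E // Commute S T}, {z | y (S.1 z) = 0} := by
      ext z; simp only [SetLike.mem_coe, hM, mem_iInter, Subtype.forall, mem_ofPred_eq]
    rw [this]
    exact isClosed_iInter fun S => isClosed_eq (y.continuous.comp S.1.continuous) continuous_const
  · intro h
    have : x ∈ M := (hM x).2 key
    rw [h, Submodule.mem_bot] at this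
    apply hax
    rw [← hLx, this, map_zero]
  · intro h
    have : X 0 ∈ M := h ▸ Submodule.mem_top
    have h0 := (hM _).1 this 1 (Commute.one_left T)
    apply hbx
    rw [← h0, one_apply_eq_self, hyz]
    refine tsum_congr fun n => ?_
    have := pairing_shift T 1 (Commute.one_left T) hr X Y hX hY n 0
    simp only [one_apply_eq_self, zero_add] at this
    rw [this]
  · intro S hS f hf
    rw [hM] at hf ⊢
    intro S' hS'
    exact hf (S' * S) (hS'.mul_left hS)

end Abstract

/-! ### Rapidly decreasing coefficients of a series vanishing on an interval. -/

section TrigonometricSeries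

/-- The character `t ↦ exp (2πint)`. -/
noncomputable def trigChar (n : ℤ) (t : ℝ) : ℂ := Complex.exp (2 * Real.pi * Complex.I * n * t)

theorem trigChar_eq (n : ℤ) (t : ℝ) :
    trigChar n t = Complex.exp (((2 * Real.pi * n * t : ℝ) : ℂ) * Complex.I) := by
  rw [trigChar]; congr 1; push_cast; ring

theorem norm_trigChar (n : ℤ) (t : ℝ) : ‖trigChar n t‖ = 1 := by
  rw [trigChar_eq, Complex.norm_exp_ofReal_mul_I]

theorem trigChar_zero (t : ℝ) : trigChar 0 t = 1 := by simp [trigChar]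

theorem trigChar_add_index (m n : ℤ) (t : ℝ) :
    trigChar (m + n) t = trigChar m t * trigChar n t := by
  rw [trigChar, trigChar, trigChar, ← Complex.exp_add]; congr 1; push_cast; ring

theorem trigChar_add (n : ℤ) (s t : ℝ) : trigChar n (s + t) = trigChar n s * trigChar n t := by
  rw [trigChar, trigChar, trigChar, ← Complex.exp_add]; congr 1; push_cast; ring

theorem trigChar_add_one (n : ℤ) (t : ℝ) : trigChar n (t + 1) = trigChar n t := by
  rw [trigChar_add]
  have : trigChar n 1 = 1 := by
    rw [trigChar, ← Complex.exp_int_mul_two_pi_mul_I n]; congr 1; push_cast; ring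
  rw [this, mul_one]

theorem trigChar_half (n : ℤ) : trigChar n (1 / 2) = (-1) ^ n := by
  rw [trigChar, ← Complex.exp_pi_mul_I, ← Complex.exp_int_mul]; congr 1; push_cast; ring

theorem continuous_trigChar (n : ℤ) : Continuous (trigChar n) := by
  unfold trigChar; fun_prop

theorem integral_trigChar_symm (n : ℤ) (t : ℝ) {δ : ℝ} (hδ : 0 < δ) :
    ∫ u in (t - δ)..(t + δ), trigChar n u =
      2 * δ * Real.sinc (2 * Real.pi * n * δ) * trigChar n t := by
  rcases eq_or_ne n 0 with rfl | hn
  · simp [trigChar_zero]; ring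
  have hc : 2 * (Real.pi : ℂ) * Complex.I * n ≠ 0 := by
    simp [Real.pi_ne_zero, hn]
  have hne : 2 * Real.pi * n * δ ≠ 0 := by
    have : (n : ℝ) ≠ 0 := by exact_mod_cast hn
    positivity
  have hδ' : (δ : ℂ) ≠ 0 := by exact_mod_cast hδ.ne'
  have hn' : (n : ℂ) ≠ 0 := by exact_mod_cast hn
  have hpi : (Real.pi : ℂ) ≠ 0 := by exact_mod_cast Real.pi_ne_zero
  have h1 : ∫ u in (t - δ)..(t + δ), trigChar n u =
      (trigChar n (t + δ) - trigChar n (t - δ)) / (2 * Real.pi * Complex.I * n) :=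
    integral_exp_mul_complex hc
  have h2 : ((Real.sin (2 * Real.pi * n * δ) : ℝ) : ℂ) =
      (trigChar n (-δ) - trigChar n δ) * Complex.I / 2 := by
    rw [Complex.ofReal_sin, Complex.sin, trigChar_eq, trigChar_eq]
    congr 4
    push_cast; ring
  rw [h1, Real.sinc_of_ne_zero hne, Complex.ofReal_div, h2, sub_eq_add_neg t, trigChar_add,
    trigChar_add]
  push_cast
  field_simp
  rw [Complex.I_sq]
  ring

theorem hasSum_integral_trigSeries {c : ℤ → ℂ} (hc : Summable fun n => ‖c n‖) (a b : ℝ) :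
    HasSum (fun n => c n * ∫ u in a..b, trigChar n u)
      (∫ u in a..b, ∑' n, c n * trigChar n u) := by
  have := intervalIntegral.hasSum_integral_of_dominated_convergence (a := a) (b := b)
    (μ := volume) (F := fun n u => c n * trigChar n u)
    (f := fun u => ∑' n, c n * trigChar n u) (fun n _ => ‖c n‖)
    (fun n => ((continuous_trigChar n).const_mul (c n)).aestronglyMeasurable)
    (fun n => ae_of_all _ fun u _ => by simp [norm_trigChar])
    (ae_of_all _ fun u _ => hc) (by simp)
    (ae_of_all _ fun u _ => (Summable.of_norm (by simpa [norm_trigChar] using hc)).hasSum)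
  simpa [intervalIntegral.integral_const_mul] using this

theorem coeff_eq_zero_of_trigSeries_eq_zero {c : ℤ → ℂ} (hc : Summable fun n => ‖c n‖)
    (h : ∀ t ∈ Icc (0 : ℝ) 1, ∑' n, c n * trigChar n t = 0) (k : ℤ) : c k = 0 := by
  have hc' : Summable fun n => ‖c (n + k)‖ := (Equiv.addRight k).summable_iff.2 hc
  have h1 := hasSum_integral_trigSeries hc' (1 / 2 - 1 / 2) (1 / 2 + 1 / 2)
  have h2 : ∫ u in (1 / 2 - 1 / 2 : ℝ)..(1 / 2 + 1 / 2), ∑' n, c (n + k) * trigChar n u = 0 := by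
    rw [intervalIntegral.integral_congr (g := fun _ => (0 : ℂ))]
    · simp
    intro u hu
    rw [uIcc_of_le (by norm_num)] at hu
    have h0 := h u (by constructor <;> linarith [hu.1, hu.2])
    rw [← (Equiv.addRight k).tsum_eq] at h0
    simp only [Equiv.coe_addRight, trigChar_add_index, ← mul_assoc, tsum_mul_right] at h0
    exact (mul_eq_zero.1 h0).resolve_right (by
      intro h; have := norm_trigChar k u; simp [h] at this)
  rw [h2] at h1
  have h3 : ∀ n ≠ (0 : ℤ), c (n + k) * ∫ u in (1 / 2 - 1 / 2 : ℝ)..(1 / 2 + 1 / 2), trigChar n u = 0 := by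
    intro n hn
    rw [integral_trigChar_symm n _ (by norm_num : (0 : ℝ) < 1 / 2), Real.sinc_of_ne_zero]
    · rw [show 2 * Real.pi * n * (1 / 2) = n * Real.pi by ring, Real.sin_int_mul_pi]; simp
    · have : (n : ℝ) ≠ 0 := by exact_mod_cast hn
      positivity
  have h4 := h1.unique (hasSum_single 0 h3)
  simpa [trigChar_zero] using h4.symm

/-- The trigonometric series with coefficients `a` converges absolutely, and its sum vanishes at the
points of `[s, 1 - s]`. -/
def TrigSeriesVanishes (a : ℤ → ℝ) (s : ℝ) : Prop :=
  Summable (fun n => |a n|) ∧ ∀ t ∈ Icc s (1 - s), ∑' n, (a n : ℂ) * trigChar n t = 0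

/-- Multiplying the coefficients by this `sinc` averages the sum over `[t - δ, t + δ]`, so the
interval of zeros loses only `δ` at each end. -/
theorem TrigSeriesVanishes.mul_sinc {a : ℤ → ℝ} {s δ : ℝ} (h : TrigSeriesVanishes a s)
    (hδ : 0 < δ) :
    TrigSeriesVanishes (fun n => a n * Real.sinc (2 * Real.pi * n * δ)) (s + δ) := by
  refine ⟨?_, ?_⟩
  · refine Summable.of_nonneg_of_le (fun _ => abs_nonneg _) (fun n => ?_) h.1
    rw [abs_mul]
    exact mul_le_of_le_one_right (abs_nonneg _) (Real.abs_sinc_le_one _)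
  · intro t ht
    have h1 := hasSum_integral_trigSeries (c := fun n => (a n : ℂ))
      (by simpa using h.1) (t - δ) (t + δ)
    rw [intervalIntegral.integral_congr (g := fun _ => (0 : ℂ))] at h1
    · simp only [integral_trigChar_symm _ _ hδ, intervalIntegral.integral_zero] at h1
      have h2 := h1.tsum_eq
      have h3 : ∀ n : ℤ, (a n : ℂ) * (2 * δ * Real.sinc (2 * Real.pi * n * δ) * trigChar n t) =
          2 * δ * (((a n * Real.sinc (2 * Real.pi * n * δ) : ℝ) : ℂ) * trigChar n t) := by
        intro n; push_cast; ring
      simp_rw [h3, tsum_mul_left] at h2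
      have hδ' : (δ : ℂ) ≠ 0 := by exact_mod_cast hδ.ne'
      simpa [hδ'] using h2
    · intro u hu
      rw [uIcc_of_le (by linarith)] at hu
      exact h.2 u ⟨by linarith [hu.1, ht.1], by linarith [hu.2, ht.2]⟩

theorem TrigSeriesVanishes.mul_sinc_pow {a : ℤ → ℝ} {s δ : ℝ} (h : TrigSeriesVanishes a s)
    (hδ : 0 < δ) (N : ℕ) :
    TrigSeriesVanishes (fun n => a n * Real.sinc (2 * Real.pi * n * δ) ^ N) (s + N * δ) := by
  induction N with
  | zero => simpa using h
  | succ N ih =>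
    convert ih.mul_sinc hδ using 1
    · ext n; ring
    · push_cast; ring

theorem TrigSeriesVanishes.mul_prod {a : ℤ → ℝ} {s : ℝ} (h : TrigSeriesVanishes a s)
    {δ : ℕ → ℝ} (hδ : ∀ j, 0 < δ j) (N : ℕ → ℕ) (J : ℕ) :
    TrigSeriesVanishes
      (fun n => a n * ∏ j ∈ Finset.range J, Real.sinc (2 * Real.pi * n * δ j) ^ N j)
      (s + ∑ j ∈ Finset.range J, N j * δ j) := by
  induction J with
  | zero => simpa using h
  | succ J ih =>
    convert ih.mul_sinc_pow (hδ J) (N J) using 1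
    · ext n; rw [Finset.prod_range_succ, ← mul_assoc]
    · rw [Finset.sum_range_succ, add_assoc]

theorem TrigSeriesVanishes.mono {a : ℤ → ℝ} {s s' : ℝ} (h : TrigSeriesVanishes a s)
    (hs : s ≤ s') : TrigSeriesVanishes a s' :=
  ⟨h.1, fun t ht => h.2 t ⟨hs.trans ht.1, by linarith [ht.2]⟩⟩

theorem TrigSeriesVanishes.of_tendsto {a : ℕ → ℤ → ℝ} {a' : ℤ → ℝ} {s : ℝ} {B : ℤ → ℝ}
    (h : ∀ J, TrigSeriesVanishes (a J) s) (hB : Summable B) (hle : ∀ J n, |a J n| ≤ B n)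
    (hlim : ∀ n, Filter.Tendsto (fun J => a J n) Filter.atTop (nhds (a' n))) :
    TrigSeriesVanishes a' s := by
  have hle' : ∀ n, |a' n| ≤ B n := fun n => le_of_tendsto (hlim n).abs (.of_forall fun J => hle J n)
  refine ⟨Summable.of_nonneg_of_le (fun _ => abs_nonneg _) hle' hB, fun t ht => ?_⟩
  have h1 := tendsto_tsum_of_dominated_convergence (𝓕 := Filter.atTop)
    (f := fun J n => (a J n : ℂ) * trigChar n t) (g := fun n => (a' n : ℂ) * trigChar n t) hB
    (fun n => (((Complex.continuous_ofReal.tendsto _).comp (hlim n)).mul_const _))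
    (.of_forall fun J n => by simpa [norm_trigChar] using hle J n)
  simp only [fun J => (h J).2 t ht] at h1
  exact tendsto_nhds_unique h1 tendsto_const_nhds

/-- Fourier coefficients of a triangle function supported in `[-1/8, 1/8]` modulo `1`. -/
noncomputable def triangleCoeff (n : ℤ) : ℝ :=
  if n = 0 then -Real.pi ^ 2 / 16 else (2 * Real.cos (Real.pi * n / 4) - 2) / n ^ 2

theorem abs_triangleCoeff_le {n : ℤ} (hn : n ≠ 0) : |triangleCoeff n| ≤ 4 / (n : ℝ) ^ 2 := by
  rw [triangleCoeff, if_neg hn, abs_div, abs_of_nonneg (sq_nonneg (n : ℝ))]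
  gcongr
  rw [abs_le]
  constructor <;> linarith [Real.cos_le_one (Real.pi * n / 4), Real.neg_one_le_cos (Real.pi * n / 4)]

theorem trigSeriesVanishes_triangleCoeff : TrigSeriesVanishes triangleCoeff (1 / 8) := by
  constructor
  · have h : Summable fun n : ℤ => 4 * (1 / (n : ℝ) ^ 2) :=
      (Real.summable_one_div_int_pow.2 (by norm_num)).mul_left 4
    refine Summable.of_norm_bounded_eventually h ?_
    filter_upwards [Set.Finite.compl_mem_cofinite (finite_singleton (0 : ℤ))] with n hn
    have := abs_triangleCoeff_le (n := n) (by simpa using hn)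
    simpa [div_eq_mul_inv] using this
  · intro t ht
    -- The triangle is a second difference, with step `1/8`, of the quadratic Bernoulli series. Away
    -- from the corners that difference is the constant `π² / 16`, which the coefficient at `0`
    -- cancels. The term `n = 0` here is zero because `1 / 0 = 0`.
    have key : ∀ x ∈ Icc (0 : ℝ) 1, HasSum (fun n : ℤ => 1 / (n : ℂ) ^ 2 * trigChar n x)
        ((2 * Real.pi ^ 2 * (x ^ 2 - x + 6⁻¹) : ℝ) : ℂ) := by
      intro x hx
      have := hasSum_one_div_pow_mul_fourier_mul_bernoulliFun (le_refl 2) hx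
      convert this using 1
      · ext n; rw [fourier_coe_apply, trigChar]; simp
      · rw [bernoulliFun_two]; push_cast [Nat.factorial]; rw [mul_pow, Complex.I_sq]; ring
    have h1 := key (t + 1 / 8) ⟨by linarith [ht.1], by linarith [ht.2]⟩
    have h2 := key (t + -(1 / 8)) ⟨by linarith [ht.1], by linarith [ht.2]⟩
    have h3 := key t ⟨by linarith [ht.1], by linarith [ht.2]⟩
    have h4 := ((h1.add h2).sub (h3.mul_left 2)).add
      (hasSum_ite_eq (0 : ℤ) ((-Real.pi ^ 2 / 16 : ℝ) : ℂ))
    have hv : ((2 * Real.pi ^ 2 * ((t + 1 / 8) ^ 2 - (t + 1 / 8) + 6⁻¹) : ℝ) : ℂ) +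
        ((2 * Real.pi ^ 2 * ((t + -(1 / 8)) ^ 2 - (t + -(1 / 8)) + 6⁻¹) : ℝ) : ℂ) -
        2 * ((2 * Real.pi ^ 2 * (t ^ 2 - t + 6⁻¹) : ℝ) : ℂ) +
        ((-Real.pi ^ 2 / 16 : ℝ) : ℂ) = 0 := by push_cast; ring
    rw [hv] at h4
    have h5 : HasSum (fun n => (triangleCoeff n : ℂ) * trigChar n t) 0 := by
      refine Eq.subst (motive := fun f => HasSum f 0) (funext fun n => ?_) h4
      symm
      rcases eq_or_ne n 0 with rfl | hn
      · simp [triangleCoeff, trigChar_zero]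
      · rw [triangleCoeff, if_neg hn, if_neg hn, trigChar_add, trigChar_add]
        have : ((2 * Real.cos (Real.pi * n / 4) : ℝ) : ℂ) =
            trigChar n (1 / 8) + trigChar n (-(1 / 8)) := by
          rw [Complex.ofReal_mul, Complex.ofReal_cos, Complex.cos, trigChar_eq, trigChar_eq]
          have e1 : ((2 * Real.pi * n * (1 / 8) : ℝ) : ℂ) * Complex.I =
              ((Real.pi * n / 4 : ℝ) : ℂ) * Complex.I := by push_cast; ring
          have e2 : ((2 * Real.pi * n * (-(1 / 8)) : ℝ) : ℂ) * Complex.I =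
              -((Real.pi * n / 4 : ℝ) : ℂ) * Complex.I := by push_cast; ring
          rw [e1, e2]; push_cast; ring
        rw [Complex.ofReal_div, Complex.ofReal_sub, this]
        push_cast; ring
    exact h5.tsum_eq

/-- The factor `(-1) ^ n` translates the sum by `1/2`. At each point either the sum or its translate
vanishes, so their product is zero, and the convolution consists of the coefficients of that
product. -/
theorem convolution_alternating_eq_zero {a : ℤ → ℝ} (h : TrigSeriesVanishes a (1 / 4)) (k : ℤ) :
    ∑' n, (a n : ℂ) * ((-1) ^ (k - n) * (a (k - n) : ℂ)) = 0 := by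
  set b : ℤ → ℂ := fun n => (-1) ^ n * (a n : ℂ) with hb
  have ha : Summable fun n => ‖(a n : ℂ)‖ := by simpa using h.1
  have hbs : Summable fun n => ‖b n‖ := by simpa [hb] using h.1
  let ε : ℤ × ℤ ≃ ℤ × ℤ :=
    { toFun := fun q => (q.2, q.1 - q.2)
      invFun := fun q => (q.1 + q.2, q.1)
      left_inv := fun q => by ext <;> simp
      right_inv := fun q => by ext <;> simp }
  have hs : Summable fun q : ℤ × ℤ => ‖(a q.1 : ℂ)‖ * ‖b q.2‖ :=
    ha.mul_of_nonneg hbs (fun _ => norm_nonneg _) (fun _ => norm_nonneg _)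
  have hs' : Summable fun q : ℤ × ℤ => ‖(a q.2 : ℂ)‖ * ‖b (q.1 - q.2)‖ := ε.summable_iff.2 hs
  refine coeff_eq_zero_of_trigSeries_eq_zero (c := fun k => ∑' n, (a n : ℂ) * b (k - n)) ?_ ?_ k
  · refine Summable.of_nonneg_of_le (fun _ => norm_nonneg _) (fun k => ?_) hs'.prod
    have := hs'.prod_factor k
    simpa [norm_mul] using norm_tsum_le_tsum_norm (f := fun n => (a n : ℂ) * b (k - n))
      (by simpa [norm_mul] using this)
  · intro t ht
    have h1 : Summable fun q : ℤ × ℤ => (a q.1 * trigChar q.1 t) * (b q.2 * trigChar q.2 t) :=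
      Summable.of_norm (by simpa [norm_mul, norm_trigChar] using hs)
    have h2 : (∑' n, (a n : ℂ) * trigChar n t) * (∑' n, b n * trigChar n t) =
        ∑' k, (∑' n, (a n : ℂ) * b (k - n)) * trigChar k t := by
      rw [tsum_mul_tsum_of_summable_norm (by simpa [norm_mul, norm_trigChar] using ha)
        (by simpa [norm_mul, norm_trigChar] using hbs), ← ε.tsum_eq]
      have h3 := ε.summable_iff.2 h1
      refine (h3.tsum_prod' fun m => h3.prod_factor m).trans (tsum_congr fun k => ?_)
      rw [← tsum_mul_right]
      refine tsum_congr fun n => ?_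
      simp only [ε, Function.comp_apply, Equiv.coe_fn_mk]
      have : trigChar k t = trigChar n t * trigChar (k - n) t := by
        rw [← trigChar_add_index, add_sub_cancel]
      rw [this]; ring
    rw [← h2]
    have h4 : ∀ n, b n * trigChar n t = a n * trigChar n (1 / 2 + t) := by
      intro n; rw [trigChar_add, trigChar_half, hb]; ring
    rcases le_or_gt (1 / 4) t with h5 | h5
    · rcases le_or_gt t (3 / 4) with h6 | h6
      · rw [h.2 t ⟨h5, by linarith⟩, zero_mul]
      · have h7 : ∀ n, b n * trigChar n t = a n * trigChar n (t - 1 / 2) := by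
          intro n; rw [h4, ← trigChar_add_one n (t - 1 / 2)]; congr 2; ring
        simp_rw [h7]
        rw [h.2 (t - 1 / 2) ⟨by linarith, by linarith [ht.2]⟩, mul_zero]
    · simp_rw [h4]
      rw [h.2 (1 / 2 + t) ⟨by linarith [ht.1], by linarith⟩, mul_zero]

/-- Multiply the triangle's coefficients by powers of `sinc (2πn / 2 ^ m)`, with exponent about `2 *
H m`. The supports widen by the exponent times `2 ^ (-m)`, which is summable; for `|n| ≥ 2 ^ m` the
factor alone is at most `exp (-H m)`. -/
theorem exists_convolution_eq_zero_of_summable {H : ℕ → ℝ}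
    (hs : Summable fun m => H m / 2 ^ m) (hH : ∀ m, 0 ≤ H m) :
    ∃ a : ℤ → ℝ, a 0 ≠ 0 ∧ (∃ m₀ : ℕ, ∀ m ≥ m₀, ∀ n : ℤ, 2 ^ m ≤ n.natAbs →
      |a n| ≤ 4 / (n : ℝ) ^ 2 * Real.exp (-H m)) ∧
      ∀ k, ∑' n, (a n : ℂ) * ((-1) ^ (k - n) * (a (k - n) : ℂ)) = 0 := by
  -- Even exponents make every factor nonnegative, so the partial products decrease and converge to
  -- their infimum.
  let N : ℕ → ℕ := fun m => 2 * ⌈H m⌉₊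
  have hN : ∀ m, H m ≤ N m := by
    intro m
    have := Nat.le_ceil (H m)
    simp only [N]; push_cast; linarith [Nat.cast_nonneg (α := ℝ) ⌈H m⌉₊]
  have hNs : Summable fun m => (N m : ℝ) * (1 / 2 ^ m) := by
    have h1 : Summable fun m => 2 * (H m / 2 ^ m) + 2 * (1 / 2) ^ m :=
      (hs.mul_left 2).add (summable_geometric_two.mul_left 2)
    refine Summable.of_nonneg_of_le (fun m => by positivity) (fun m => ?_) h1
    have := (Nat.ceil_lt_add_one (hH m)).le
    simp only [N]; push_cast
    calc 2 * (⌈H m⌉₊ : ℝ) * (1 / 2 ^ m) ≤ 2 * (H m + 1) * (1 / 2 ^ m) := by gcongr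
      _ = _ := by rw [div_pow, one_pow]; ring
  -- The triangle occupies `1/8` on each side of `0`; dropping the first `m₀` factors keeps the
  -- further widening below `1/8`, for a total of `1/4`.
  obtain ⟨m₀, hm₀⟩ : ∃ m₀, ∑' j, (N (j + m₀) : ℝ) * (1 / 2 ^ (j + m₀)) ≤ 1 / 8 :=
    ((tendsto_sum_nat_add fun m => (N m : ℝ) * (1 / 2 ^ m)).eventually_le_const
      (by norm_num : (0 : ℝ) < 1 / 8)).exists
  have hNs' : Summable fun j => (N (j + m₀) : ℝ) * (1 / 2 ^ (j + m₀)) :=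
    (summable_nat_add_iff m₀).2 hNs
  let f : ℤ → ℕ → ℝ := fun n j => Real.sinc (2 * Real.pi * n * (1 / 2 ^ (j + m₀))) ^ N (j + m₀)
  have hf0 : ∀ n j, 0 ≤ f n j := fun n j => (even_two_mul _).pow_nonneg _
  have hf1 : ∀ n j, f n j ≤ 1 := by
    intro n j
    have : |f n j| ≤ 1 := by
      simp only [f, abs_pow]; exact pow_le_one₀ (abs_nonneg _) (Real.abs_sinc_le_one _)
    exact (abs_le.1 this).2
  let P : ℤ → ℕ → ℝ := fun n J => ∏ j ∈ Finset.range J, f n j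
  have hP0 : ∀ n J, 0 ≤ P n J := fun n J => Finset.prod_nonneg fun j _ => hf0 n j
  have hP1 : ∀ n J, P n J ≤ 1 := fun n J =>
    Finset.prod_le_one (fun j _ => hf0 n j) fun j _ => hf1 n j
  have hPanti : ∀ n, Antitone (P n) := fun n => antitone_nat_of_succ_le fun J => by
    simp only [P, Finset.prod_range_succ]
    exact mul_le_of_le_one_right (hP0 n J) (hf1 n J)
  have hPle : ∀ n j, P n (j + 1) ≤ f n j := by
    intro n j
    simp only [P, Finset.prod_range_succ]
    exact mul_le_of_le_one_left (hf0 n j) (hP1 n j)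
  have hbdd : ∀ n, BddBelow (range (P n)) := fun n => ⟨0, by rintro _ ⟨J, rfl⟩; exact hP0 n J⟩
  have hlim := fun n => tendsto_atTop_ciInf (hPanti n) (hbdd n)
  have hV : TrigSeriesVanishes (fun n => triangleCoeff n * ⨅ J, P n J) (1 / 4) := by
    refine TrigSeriesVanishes.of_tendsto (a := fun J n => triangleCoeff n * P n J)
      (B := fun n => |triangleCoeff n|) (fun J => ?_) trigSeriesVanishes_triangleCoeff.1 ?_
      fun n => (hlim n).const_mul _
    · refine (trigSeriesVanishes_triangleCoeff.mul_prod (δ := fun j => 1 / 2 ^ (j + m₀))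
        (fun j => by positivity) (fun j => N (j + m₀)) J).mono ?_
      have := (hNs'.sum_le_tsum (Finset.range J) fun j _ => by positivity).trans hm₀
      linarith
    · intro J n
      rw [abs_mul, abs_of_nonneg (hP0 n J)]
      exact mul_le_of_le_one_right (abs_nonneg _) (hP1 n J)
  refine ⟨_, ?_, ⟨m₀, ?_⟩, convolution_alternating_eq_zero hV⟩
  · have : ∀ J, P 0 J = 1 := fun J => by simp [P, f]
    simp [this, triangleCoeff, Real.pi_ne_zero]
  · intro m hm n hn
    obtain ⟨j, rfl⟩ := Nat.exists_eq_add_of_le' hm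
    have hn1 : (2 : ℝ) ^ (j + m₀) ≤ |(n : ℝ)| := by
      rw [← Int.cast_abs, Int.abs_eq_natAbs]; exact_mod_cast hn
    have hpos : (0 : ℝ) < 2 ^ (j + m₀) := by positivity
    have hn0 : n ≠ 0 := by
      rintro rfl; simp at hn1; linarith
    rw [abs_mul, abs_of_nonneg (le_ciInf (hP0 n))]
    refine mul_le_mul (abs_triangleCoeff_le hn0) ?_ (le_ciInf (hP0 n)) (by positivity)
    refine ((ciInf_le (hbdd n) (j + 1)).trans (hPle n j)).trans ?_
    set x : ℝ := 2 * Real.pi * n * (1 / 2 ^ (j + m₀)) with hx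
    -- Uses `2π > e`.
    have hxabs : Real.exp 1 ≤ |x| := by
      have : |x| = 2 * Real.pi * (|(n : ℝ)| / 2 ^ (j + m₀)) := by
        rw [hx, abs_mul, abs_mul, abs_of_pos (by positivity : (0 : ℝ) < 2 * Real.pi),
          abs_of_pos (by positivity : (0 : ℝ) < 1 / 2 ^ (j + m₀))]; ring
      rw [this]
      have h1 : 1 ≤ |(n : ℝ)| / 2 ^ (j + m₀) := (one_le_div hpos).2 hn1
      nlinarith [Real.pi_gt_three, Real.exp_one_lt_d9]
    have hx0 : x ≠ 0 := by
      intro h; rw [h, abs_zero] at hxabs; linarith [Real.exp_pos 1]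
    have hsinc : |Real.sinc x| ≤ Real.exp (-1) := by
      rw [Real.sinc_of_ne_zero hx0, abs_div, Real.exp_neg, ← one_div]
      exact div_le_div₀ zero_le_one (Real.abs_sin_le_one x) (Real.exp_pos 1) hxabs
    calc f n j ≤ |Real.sinc x| ^ N (j + m₀) := by
          simp only [f]; rw [← abs_pow]; exact le_abs_self _
      _ ≤ Real.exp (-1) ^ N (j + m₀) := by gcongr
      _ = Real.exp (-(N (j + m₀))) := by rw [← Real.exp_nat_mul]; congr 1; ring
      _ ≤ _ := by gcongr; exact hN _

end TrigonometricSeries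

/-! ### Discrepancy and sums of truncated logarithms. -/

section Koksma

theorem countIn_le (N : ℕ) (E : Set ℝ) (ω : ℕ → ℝ) : countIn N E ω ≤ N := by
  classical
  unfold countIn
  exact (Finset.card_filter_le _ _).trans (by simp)

theorem countIn_congr {N : ℕ} {E F : Set ℝ} {ω : ℕ → ℝ}
    (h : ∀ j ∈ Finset.Icc 1 N, ω j ∈ E ↔ ω j ∈ F) : countIn N E ω = countIn N F ω := by
  classical
  unfold countIn
  congr 1
  exact Finset.filter_congr h

theorem abs_countIn_div_sub_le_one (N : ℕ) (ω : ℕ → ℝ) {α β : ℝ} (hα : 0 ≤ α) (hαβ : α < β)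
    (hβ : β ≤ 1) : |(countIn N (Ico α β) ω : ℝ) / N - (β - α)| ≤ 1 := by
  have h1 : (countIn N (Ico α β) ω : ℝ) ≤ N := by exact_mod_cast countIn_le N (Ico α β) ω
  have h2 : (countIn N (Ico α β) ω : ℝ) / N ≤ 1 := div_le_one_of_le₀ h1 (Nat.cast_nonneg N)
  have h3 : 0 ≤ (countIn N (Ico α β) ω : ℝ) / N := by positivity
  rw [abs_le]; constructor <;> linarith

theorem abs_countIn_div_sub_le (N : ℕ) (ω : ℕ → ℝ) {α β : ℝ} (hα : 0 ≤ α) (hαβ : α < β)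
    (hβ : β ≤ 1) : |(countIn N (Ico α β) ω : ℝ) / N - (β - α)| ≤ seqDiscrepancy N ω := by
  refine le_csSup ⟨1, ?_⟩ ⟨α, β, hα, hαβ, hβ, rfl⟩
  rintro _ ⟨a, b, ha, hab, hb, rfl⟩
  exact abs_countIn_div_sub_le_one N ω ha hab hb

theorem seqDiscrepancy_le_one (N : ℕ) (ω : ℕ → ℝ) : seqDiscrepancy N ω ≤ 1 := by
  refine csSup_le ⟨_, 0, 1, le_rfl, one_pos, le_rfl, rfl⟩ ?_
  rintro _ ⟨a, b, ha, hab, hb, rfl⟩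
  exact abs_countIn_div_sub_le_one N ω ha hab hb

theorem seqDiscrepancy_le_mapDiscrepancy (τ : unitInterval → unitInterval) (N : ℕ)
    {x : unitInterval} (hx : (x : ℝ) < 1) :
    seqDiscrepancy N (fun n => ((τ^[n] x : unitInterval) : ℝ)) ≤ mapDiscrepancy τ N := by
  refine le_csSup ⟨1, ?_⟩ ⟨x, hx, rfl⟩
  rintro _ ⟨y, -, rfl⟩
  exact seqDiscrepancy_le_one N _

theorem abs_countIn_sub_le (N : ℕ) (ω : ℕ → ℝ) {α β : ℝ} (hα : 0 ≤ α) (hαβ : α < β) (hβ : β ≤ 1) :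
    |(countIn N (Ico α β) ω : ℝ) - N * (β - α)| ≤ N * seqDiscrepancy N ω := by
  rcases Nat.eq_zero_or_pos N with rfl | hN
  · simp [countIn]
  have hN' : (0 : ℝ) < N := by exact_mod_cast hN
  calc |(countIn N (Ico α β) ω : ℝ) - N * (β - α)|
      = N * |(countIn N (Ico α β) ω : ℝ) / N - (β - α)| := by
        rw [← abs_of_pos hN', ← abs_mul, abs_of_pos hN']; congr 1; field_simp
    _ ≤ _ := by gcongr; exact abs_countIn_div_sub_le N ω hα hαβ hβ

/-- The length of `(c - s, c + s) ∩ [0, 1]`. -/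
noncomputable def clippedLength (c s : ℝ) : ℝ := min (c + s) 1 - max (c - s) 0

/-- The value of `∫ t in 0..1, log |t - c|` given by the layer cake formula. -/
noncomputable def logMean (c : ℝ) : ℝ := -∫ s in (0 : ℝ)..1, clippedLength c s / s

theorem intervalIntegrable_indicator_one_div (ω c : ℝ) {a b : ℝ} (ha : 0 < a) (hab : a ≤ b) :
    IntervalIntegrable ({s | ω ∈ Ico (c - s) (c + s)}.indicator (fun s => 1 / s)) volume a b := by
  have h : IntervalIntegrable (fun s : ℝ => 1 / s) volume a b := by
    refine intervalIntegral.intervalIntegrable_one_div (fun x hx => ?_) continuousOn_id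
    rw [uIcc_of_le hab] at hx
    exact (ha.trans_le hx.1).ne'
  rw [intervalIntegrable_iff] at h ⊢
  have hm : MeasurableSet ({s : ℝ | c - s ≤ ω} ∩ {s : ℝ | ω < c + s}) :=
    (measurableSet_le (by fun_prop) (by fun_prop)).inter
      (measurableSet_lt (by fun_prop) (by fun_prop))
  exact h.indicator hm

/-- A layer-cake formula: it turns sums of logarithms into integrals of counting functions of
intervals. These are taken half-open to match the discrepancy. -/
theorem log_max_eq_integral {ω c η : ℝ} (h : |ω - c| ≤ 1) (h0 : 0 < η) (h1 : η ≤ 1) :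
    Real.log (max |ω - c| η) =
      -∫ s in η..1, {s | ω ∈ Ico (c - s) (c + s)}.indicator (fun s => 1 / s) s := by
  set d := max |ω - c| η with hd
  have hηd : η ≤ d := le_max_right _ _
  have hd1 : d ≤ 1 := max_le h h1
  have e1 : ∫ s in η..d, {s | ω ∈ Ico (c - s) (c + s)}.indicator (fun s => 1 / s) s = 0 := by
    rw [intervalIntegral.integral_of_le hηd, integral_Ioc_eq_integral_Ioo,
      setIntegral_congr_fun (g := fun _ => (0 : ℝ)) measurableSet_Ioo]
    · simp
    · intro s hs
      refine indicator_of_notMem ?_ _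
      rintro ⟨h2, h3⟩
      have : d ≤ s := max_le (abs_le.2 ⟨by linarith, by linarith⟩) hs.1.le
      exact absurd hs.2 (not_lt.2 this)
  have heq : EqOn ({s | ω ∈ Ico (c - s) (c + s)}.indicator (fun s => 1 / s)) (fun s => 1 / s)
      (Ioo d 1) := by
    intro s hs
    refine indicator_of_mem ?_ _
    have := abs_lt.1 ((le_max_left |ω - c| η).trans_lt hs.1)
    exact ⟨by linarith [this.1], by linarith [this.2]⟩
  have e2 : ∫ s in d..1, {s | ω ∈ Ico (c - s) (c + s)}.indicator (fun s => 1 / s) s =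
      -Real.log d := by
    rw [intervalIntegral.integral_of_le hd1, integral_Ioc_eq_integral_Ioo,
      setIntegral_congr_fun measurableSet_Ioo heq, ← integral_Ioc_eq_integral_Ioo,
      ← intervalIntegral.integral_of_le hd1, integral_one_div_of_pos (h0.trans_le hηd) one_pos]
    simp
  rw [← intervalIntegral.integral_add_adjacent_intervals (intervalIntegrable_indicator_one_div ω c h0 hηd)
    (intervalIntegrable_indicator_one_div ω c (h0.trans_le hηd) hd1), e1, e2]
  simp

theorem clippedLength_nonneg {c s : ℝ} (hc : c ∈ Icc (0 : ℝ) 1) (hs : 0 ≤ s) :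
    0 ≤ clippedLength c s := by
  unfold clippedLength
  rw [sub_nonneg]
  exact max_le (le_min (by linarith) (by linarith [hc.2])) (le_min (by linarith [hc.1]) zero_le_one)

theorem clippedLength_le (c s : ℝ) : clippedLength c s ≤ 2 * s := by
  unfold clippedLength
  linarith [min_le_left (c + s) 1, le_max_left (c - s) 0]

theorem norm_clippedLength_div_le {c s : ℝ} (hc : c ∈ Icc (0 : ℝ) 1) (hs : 0 ≤ s) :
    ‖clippedLength c s / s‖ ≤ 2 := by
  rw [Real.norm_of_nonneg (div_nonneg (clippedLength_nonneg hc hs) hs)]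
  exact div_le_of_le_mul₀ hs (by norm_num) (clippedLength_le c s)

theorem intervalIntegrable_clippedLength_div {c a b : ℝ} (hc : c ∈ Icc (0 : ℝ) 1) (ha : 0 ≤ a)
    (hab : a ≤ b) : IntervalIntegrable (fun s => clippedLength c s / s) volume a b := by
  rw [intervalIntegrable_iff]
  refine Measure.integrableOn_of_bounded (M := 2) (by simp) ?_ ?_
  · unfold clippedLength
    exact Measurable.aestronglyMeasurable (by fun_prop)
  · refine (ae_restrict_mem measurableSet_uIoc).mono fun s hs => ?_
    rw [uIoc_of_le hab] at hs
    exact norm_clippedLength_div_le hc (ha.trans hs.1.le)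

/-- For each `s` in `[η, 1]` the count differs from `N` times the clipped length by at most `N *
D_N`. Integrating against `ds / s` gives the logarithm, and the part of `logMean` below `η` costs `2
* η * N`. -/
theorem abs_sum_log_max_sub_le (N : ℕ) {ω : ℕ → ℝ} {c η : ℝ} (hω : ∀ j ∈ Finset.Icc 1 N, ω j ∈ Ico (0 : ℝ) 1)
    (hc : c ∈ Icc (0 : ℝ) 1) (h0 : 0 < η) (h1 : η ≤ 1) :
    |∑ j ∈ Finset.Icc 1 N, Real.log (max |ω j - c| η) - N * logMean c| ≤
      N * seqDiscrepancy N ω * Real.log (1 / η) + 2 * η * N := by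
  have hint := fun w => intervalIntegrable_indicator_one_div w c h0 h1
  have hcnt : ∀ s, ∑ j ∈ Finset.Icc 1 N,
      {s | ω j ∈ Ico (c - s) (c + s)}.indicator (fun s => 1 / s) s =
        (countIn N (Ico (c - s) (c + s)) ω : ℝ) * (1 / s) := by
    intro s
    classical
    simp only [indicator_apply, mem_ofPred_eq, countIn]
    rw [Finset.sum_ite, Finset.sum_const_zero, add_zero, Finset.sum_const, nsmul_eq_mul]
    congr!
  have e1 : ∑ j ∈ Finset.Icc 1 N, Real.log (max |ω j - c| η) =
      -∫ s in η..1, (countIn N (Ico (c - s) (c + s)) ω : ℝ) * (1 / s) := by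
    simp_rw [← hcnt]
    rw [intervalIntegral.integral_finsetSum fun j _ => hint (ω j), ← Finset.sum_neg_distrib]
    refine Finset.sum_congr rfl fun j hj => log_max_eq_integral ?_ h0 h1
    have := hω j hj
    rw [abs_le]
    constructor <;> linarith [this.1, this.2, hc.1, hc.2]
  have hintc : IntervalIntegrable (fun s => (countIn N (Ico (c - s) (c + s)) ω : ℝ) * (1 / s))
      volume η 1 := by
    simp_rw [← hcnt]
    have := IntervalIntegrable.sum (Finset.Icc 1 N) fun j _ => hint (ω j)
    rwa [Finset.sum_fn] at this
  have e2 : logMean c = -(∫ s in (0 : ℝ)..η, clippedLength c s / s) -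
      ∫ s in η..1, clippedLength c s / s := by
    rw [logMean, ← intervalIntegral.integral_add_adjacent_intervals
      (intervalIntegrable_clippedLength_div hc le_rfl h0.le)
      (intervalIntegrable_clippedLength_div hc h0.le h1)]
    ring
  have e3 : ∫ s in η..1, ((countIn N (Ico (c - s) (c + s)) ω : ℝ) * (1 / s) -
        N * (clippedLength c s / s)) =
      (∫ s in η..1, (countIn N (Ico (c - s) (c + s)) ω : ℝ) * (1 / s)) -
        N * ∫ s in η..1, clippedLength c s / s := by
    rw [intervalIntegral.integral_sub hintc
      ((intervalIntegrable_clippedLength_div hc h0.le h1).const_mul _),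
      intervalIntegral.integral_const_mul]
  have b1 : |∫ s in (0 : ℝ)..η, clippedLength c s / s| ≤ 2 * η := by
    have := intervalIntegral.norm_integral_le_of_norm_le_const (a := 0) (b := η) (C := 2)
      (f := fun s => clippedLength c s / s) (fun s hs => by
        rw [uIoc_of_le h0.le] at hs
        exact norm_clippedLength_div_le hc hs.1.le)
    rwa [sub_zero, abs_of_pos h0] at this
  have b2 : |∫ s in η..1, ((countIn N (Ico (c - s) (c + s)) ω : ℝ) * (1 / s) -
        N * (clippedLength c s / s))| ≤ N * seqDiscrepancy N ω * Real.log (1 / η) := by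
    have hi : IntervalIntegrable (fun s : ℝ => N * seqDiscrepancy N ω * (1 / s)) volume η 1 := by
      refine IntervalIntegrable.const_mul ?_ _
      refine intervalIntegral.intervalIntegrable_one_div (fun x hx => ?_) continuousOn_id
      rw [uIcc_of_le h1] at hx
      exact (h0.trans_le hx.1).ne'
    have := intervalIntegral.norm_integral_le_of_norm_le h1 (f := fun s =>
      (countIn N (Ico (c - s) (c + s)) ω : ℝ) * (1 / s) - N * (clippedLength c s / s)) (μ := volume)
      (g := fun s => N * seqDiscrepancy N ω * (1 / s)) (ae_of_all _ fun s hs => ?_) hi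
    · rwa [intervalIntegral.integral_const_mul, integral_one_div_of_pos h0 one_pos] at this
    · have hs0 : 0 < s := h0.trans hs.1
      -- Clipping the interval to `[0, 1]` loses no points; at the right end this needs `ω j < 1`.
      have hco : countIn N (Ico (c - s) (c + s)) ω =
          countIn N (Ico (max (c - s) 0) (min (c + s) 1)) ω := by
        refine countIn_congr fun j hj => ?_
        have := hω j hj
        simp only [mem_Ico, max_le_iff, lt_min_iff]
        exact ⟨fun h => ⟨⟨h.1, this.1⟩, h.2, this.2⟩, fun h => ⟨h.1.1, h.2.1⟩⟩
      have hd := abs_countIn_sub_le N ω (le_max_right (c - s) 0)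
        (max_lt (lt_min (by linarith) (by linarith [hc.2])) (lt_min (by linarith [hc.1]) one_pos))
        (min_le_right (c + s) 1)
      rw [← hco] at hd
      have : (countIn N (Ico (c - s) (c + s)) ω : ℝ) * (1 / s) - N * (clippedLength c s / s) =
          ((countIn N (Ico (c - s) (c + s)) ω : ℝ) - N * (min (c + s) 1 - max (c - s) 0)) *
            (1 / s) := by
        rw [clippedLength]; ring
      rw [this, norm_mul, Real.norm_of_nonneg (by positivity : 0 ≤ 1 / s)]
      gcongr
      exact hd
  have e4 : ∑ j ∈ Finset.Icc 1 N, Real.log (max |ω j - c| η) - N * logMean c =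
      -(∫ s in η..1, ((countIn N (Ico (c - s) (c + s)) ω : ℝ) * (1 / s) -
        N * (clippedLength c s / s))) + N * ∫ s in (0 : ℝ)..η, clippedLength c s / s := by
    rw [e1, e2, e3]; ring
  rw [e4]
  refine (abs_add_le _ _).trans ?_
  rw [abs_neg, abs_mul, Nat.abs_cast]
  have : (N : ℝ) * |∫ s in (0 : ℝ)..η, clippedLength c s / s| ≤ N * (2 * η) := by gcongr
  linarith

end Koksma

/-! ### Modulus and measurability of generalized polynomials. -/

section GeneralizedPolynomial

theorem IsRealPower.abs_eq {y s z : ℝ} (hs : 0 < s) (h : IsRealPower y s z) : |z| = |y| ^ s := by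
  rcases h with ⟨hy, rfl⟩ | ⟨a, b, hb, rfl, h⟩
  · rw [abs_of_nonneg hy, abs_of_nonneg (Real.rpow_nonneg hy _)]
  · have hb0 : b ≠ 0 := hb.pos.ne'
    have h1 : |z| ^ b = |y| ^ a := by rw [← abs_pow, h, abs_pow]
    rw [← Real.pow_rpow_inv_natCast (abs_nonneg z) hb0, h1, ← Real.rpow_natCast,
      ← Real.rpow_mul (abs_nonneg y), div_eq_mul_inv]

/-- The modulus is `|y| ^ s`, so only the sign is at stake. It depends on `s` alone: the power is
even in `y` if `s` is some fraction with even numerator and odd denominator, and takes the sign of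
`y` otherwise. -/
theorem IsRealPower.measurable_comp {α : Type*} [MeasurableSpace α] {y z : α → ℝ} {s : ℝ}
    (hs : 0 < s) (hy : Measurable y) (h : ∀ x, IsRealPower (y x) s (z x)) : Measurable z := by
  have habs := fun x => (h x).abs_eq hs
  have hm : Measurable fun x => |y x| ^ s := by fun_prop
  by_cases hE : ∃ a b : ℕ, Odd b ∧ s = (a : ℝ) / b ∧ Even a
  · obtain ⟨a, b, hb, hs', ha⟩ := hE
    have hz : ∀ x, 0 ≤ z x := by
      intro x
      rcases h x with ⟨hy, hz⟩ | ⟨a', b', hb', hs'', hz⟩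
      · rw [hz]; exact Real.rpow_nonneg hy _
      · have hb0 : (b : ℝ) ≠ 0 := by exact_mod_cast hb.pos.ne'
        have hb0' : (b' : ℝ) ≠ 0 := by exact_mod_cast hb'.pos.ne'
        have e : a' * b = a * b' := by
          have : (a' : ℝ) * b = a * b' := by
            rw [hs'] at hs''; field_simp at hs''; linarith
          exact_mod_cast this
        have : Even (a' * b) := e ▸ ha.mul_right b'
        have ha' : Even a' := (Nat.even_mul.1 this).resolve_right (Nat.not_even_iff_odd.2 hb)
        exact (hb'.pow_nonneg_iff).1 (hz ▸ ha'.pow_nonneg _)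
    have : z = fun x => |y x| ^ s := by
      ext x; rw [← habs, abs_of_nonneg (hz x)]
    rw [this]; exact hm
  · have : z = fun x => if 0 ≤ y x then |y x| ^ s else -|y x| ^ s := by
      ext x
      split_ifs with hy0
      · rcases h x with ⟨hy, hz⟩ | ⟨a', b', hb', hs'', hz⟩
        · rw [hz, abs_of_nonneg hy]
        · have : 0 ≤ z x := (hb'.pow_nonneg_iff).1 (hz ▸ pow_nonneg hy0 _)
          rw [← habs, abs_of_nonneg this]
      · rcases h x with ⟨hy, hz⟩ | ⟨a', b', hb', hs'', hz⟩
        · exact absurd hy hy0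
        · have ha' : Odd a' := by
            rw [← Nat.not_even_iff_odd]
            exact fun ha => hE ⟨a', b', hb', hs'', ha⟩
          have : z x ≤ 0 := (hb'.pow_nonpos_iff).1 (hz ▸ ha'.pow_nonpos (not_le.1 hy0).le)
          rw [← habs, abs_of_nonpos this, neg_neg]
    rw [this]
    exact Measurable.ite (measurableSet_le measurable_const hy) hm hm.neg

theorem IsGeneralizedPolynomial.exists_norm_eq {v : unitInterval → ℂ}
    (hv : IsGeneralizedPolynomial v) : Measurable v ∧
    ∃ (l : ℕ) (C : ℝ) (s : Fin (l + 1) → ℝ) (c : Fin (l + 1) → unitInterval),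
      0 < C ∧ (∀ i, 0 < s i) ∧ ∀ x, ‖v x‖ = C * ∏ i, |(x : ℝ) - c i| ^ s i := by
  obtain ⟨l, C, s, c, σ, g, hC, hs, hσ, hg, hv⟩ := hv
  have habs : ∀ i t, |σ i t| = |t| := by
    intro i t
    rcases hσ i with h | h <;> rw [h]
    exact abs_abs t
  have hσm : ∀ i, Measurable (σ i) := by
    intro i
    rcases hσ i with h | h <;> rw [h] <;> fun_prop
  refine ⟨?_, l, ‖C‖, s, c, norm_pos_iff.2 hC, hs, fun x => ?_⟩
  · rw [funext hv]
    refine measurable_const.mul (Finset.measurable_prod _ fun i _ => ?_)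
    refine Complex.measurable_ofReal.comp (IsRealPower.measurable_comp (hs i) ?_ (hg i))
    exact (hσm i).comp (by fun_prop)
  · rw [hv, norm_mul, norm_prod]
    congr 1
    refine Finset.prod_congr rfl fun i _ => ?_
    rw [Complex.norm_real, Real.norm_eq_abs, (hg i x).abs_eq (hs i), habs]

end GeneralizedPolynomial

/-! ### Weighted composition operators and integral functionals. -/

section LpOperators

variable {X : Type*} [MeasurableSpace X] {μ : Measure X} [IsProbabilityMeasure μ]
  {p : ℝ≥0∞} [Fact (1 ≤ p)]

theorem exists_weightedComposition {τ : X → X} (hτ : MeasurePreserving τ μ μ) {v : X → ℂ}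
    (hv : Measurable v) {C : ℝ} (hC : ∀ x, ‖v x‖ ≤ C) :
    ∃ T : Lp ℂ p μ →L[ℂ] Lp ℂ p μ, ∀ f, (T f : X → ℂ) =ᵐ[μ] fun x => v x * (f : X → ℂ) (τ x) := by
  have hvL : MemLp v ∞ μ := MemLp.of_bound hv.aestronglyMeasurable C (ae_of_all _ hC)
  refine ⟨((ContinuousLinearMap.mul ℂ ℂ).holderL μ ∞ p p hvL.toLp).comp
    (Lp.compMeasurePreservingₗᵢ ℂ τ hτ).toContinuousLinearMap, fun f => ?_⟩
  filter_upwards [(ContinuousLinearMap.mul ℂ ℂ).coeFn_holder (r := p) hvL.toLp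
      (Lp.compMeasurePreserving τ hτ f), hvL.coeFn_toLp,
    Lp.coeFn_compMeasurePreserving f hτ] with x h1 h2 h3
  refine h1.trans ?_
  rw [h2, h3]
  rfl

/-- On a probability space the `L^1` norm is at most the `L^p` norm, so bounded kernels give
functionals for all `p`, including `p = ∞`, without duality. -/
theorem exists_integralFunctional {y : X → ℂ} (hy : Measurable y) {C : ℝ} (h0 : 0 ≤ C)
    (hC : ∀ x, ‖y x‖ ≤ C) :
    ∃ L : Lp ℂ p μ →L[ℂ] ℂ, (∀ f : Lp ℂ p μ, L f = ∫ x, y x * (f : X → ℂ) x ∂μ) ∧ ‖L‖ ≤ C := by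
  have hf : ∀ f : Lp ℂ p μ, Integrable (f : X → ℂ) μ := fun f =>
    (Lp.memLp f).integrable Fact.out
  have hint : ∀ f : Lp ℂ p μ, Integrable (fun x => y x * (f : X → ℂ) x) μ := fun f =>
    (hf f).bdd_mul hy.aestronglyMeasurable (ae_of_all _ hC)
  let L₀ : Lp ℂ p μ →ₗ[ℂ] ℂ :=
    { toFun := fun f => ∫ x, y x * (f : X → ℂ) x ∂μ
      map_add' := fun f g => by
        rw [← integral_add (hint f) (hint g)]
        refine integral_congr_ae ?_
        filter_upwards [Lp.coeFn_add f g] with x hx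
        rw [hx, Pi.add_apply, mul_add]
      map_smul' := fun c f => by
        rw [RingHom.id_apply, smul_eq_mul, ← integral_const_mul]
        refine integral_congr_ae ?_
        filter_upwards [Lp.coeFn_smul c f] with x hx
        rw [hx, Pi.smul_apply, smul_eq_mul]; ring }
  have hL : ∀ f, ‖L₀ f‖ ≤ C * ‖f‖ := by
    intro f
    have h1 : ∫ x, ‖(f : X → ℂ) x‖ ∂μ ≤ ‖f‖ := by
      rw [integral_norm_eq_lintegral_enorm (Lp.aestronglyMeasurable f), ← eLpNorm_one_eq_lintegral_enorm,
        Lp.norm_def]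
      exact ENNReal.toReal_mono (Lp.eLpNorm_ne_top f)
        (eLpNorm_le_eLpNorm_of_exponent_le Fact.out (Lp.aestronglyMeasurable f))
    calc ‖L₀ f‖ ≤ ∫ x, ‖y x * (f : X → ℂ) x‖ ∂μ := norm_integral_le_integral_norm _
      _ ≤ ∫ x, C * ‖(f : X → ℂ) x‖ ∂μ := by
          refine integral_mono (hint f).norm ((hf f).norm.const_mul C) fun x => ?_
          simp only [norm_mul]
          gcongr
          exact hC x
      _ = C * ∫ x, ‖(f : X → ℂ) x‖ ∂μ := integral_const_mul _ _
      _ ≤ _ := by gcongr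
  exact ⟨L₀.mkContinuous C hL, fun f => rfl, L₀.mkContinuous_norm_le h0 hL⟩

end LpOperators

/-! ### Two-sided products along an orbit. -/

section Cocycle

/-- The solution `z` of `z (n + 1) = q n * z n`, `z 0 = 1`, over the integers. -/
noncomputable def cocycle (q : ℤ → ℂ) : ℤ → ℂ
  | Int.ofNat n => ∏ k ∈ Finset.range n, q k
  | Int.negSucc n => ∏ k ∈ Finset.range (n + 1), (q (-((k : ℤ) + 1)))⁻¹

theorem cocycle_natCast (q : ℤ → ℂ) (n : ℕ) : cocycle q n = ∏ k ∈ Finset.range n, q k := rfl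

theorem cocycle_zero (q : ℤ → ℂ) : cocycle q 0 = 1 := by
  simpa using cocycle_natCast q 0

theorem cocycle_neg_natCast (q : ℤ → ℂ) (n : ℕ) :
    cocycle q (-(n : ℤ)) = ∏ k ∈ Finset.range n, (q (-((k : ℤ) + 1)))⁻¹ := by
  cases n with
  | zero => simpa using cocycle_zero q
  | succ n =>
    have h : -((n + 1 : ℕ) : ℤ) = Int.negSucc n := rfl
    rw [h]; rfl

theorem cocycle_add_one {q : ℤ → ℂ} (hq : ∀ n, q n ≠ 0) (n : ℤ) :
    cocycle q (n + 1) = q n * cocycle q n := by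
  obtain ⟨m, rfl | rfl⟩ := n.eq_nat_or_neg
  · rw [← Nat.cast_succ, cocycle_natCast, cocycle_natCast, Finset.prod_range_succ, mul_comm]
  · cases m with
    | zero =>
      have := cocycle_natCast q 1
      simp only [Nat.cast_one, Finset.prod_range_one] at this
      simpa [cocycle_zero] using this
    | succ m =>
      have h1 : -((m + 1 : ℕ) : ℤ) + 1 = -(m : ℤ) := by push_cast; ring
      rw [h1, cocycle_neg_natCast, cocycle_neg_natCast, Finset.prod_range_succ]
      have := hq (-((m : ℤ) + 1))
      push_cast
      field_simp

theorem norm_cocycle_le {q : ℤ → ℂ} (hq : ∀ n, q n ≠ 0) {E : ℕ → ℝ}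
    (h1 : ∀ N, |∑ k ∈ Finset.range N, Real.log ‖q k‖| ≤ E N)
    (h2 : ∀ N, |∑ k ∈ Finset.range N, Real.log ‖q (-((k : ℤ) + 1))‖| ≤ E N) (n : ℤ) :
    ‖cocycle q n‖ ≤ Real.exp (E n.natAbs) := by
  obtain ⟨m, rfl | rfl⟩ := n.eq_nat_or_neg
  · rw [cocycle_natCast, norm_prod, Int.natAbs_natCast]
    refine le_trans (le_of_eq ?_) (Real.exp_le_exp.2 ((le_abs_self _).trans (h1 m)))
    rw [Real.exp_sum]
    exact Finset.prod_congr rfl fun k _ => (Real.exp_log (norm_pos_iff.2 (hq _))).symm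
  · rw [cocycle_neg_natCast, norm_prod, Int.natAbs_neg, Int.natAbs_natCast]
    refine le_trans (le_of_eq ?_) (Real.exp_le_exp.2 ((neg_le_abs _).trans (h2 m)))
    rw [← Finset.sum_neg_distrib, Real.exp_sum]
    refine Finset.prod_congr rfl fun k _ => ?_
    rw [Real.exp_neg, Real.exp_log (norm_pos_iff.2 (hq _)), norm_inv]

theorem measurable_cocycle {X : Type*} [MeasurableSpace X] {q : X → ℤ → ℂ}
    (hq : ∀ k, Measurable fun x => q x k) (n : ℤ) : Measurable fun x => cocycle (q x) n := by
  obtain ⟨m, rfl | rfl⟩ := n.eq_nat_or_neg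
  · simp_rw [cocycle_natCast]
    exact Finset.measurable_prod _ fun k _ => hq k
  · simp_rw [cocycle_neg_natCast]
    exact Finset.measurable_prod _ fun k _ => (hq _).inv

end Cocycle

/-! ### From a set with few returns to a hyperinvariant subspace. -/

section Wandering

variable {X : Type*} [MeasurableSpace X] {μ : Measure X}

theorem measurePreserving_zpow {σ : Equiv.Perm X} (h : MeasurePreserving σ μ μ)
    (h' : MeasurePreserving ⇑σ⁻¹ μ μ) (n : ℤ) : MeasurePreserving ⇑(σ ^ n) μ μ := by
  induction n using Int.induction_on with
  | zero => exact MeasurePreserving.id μ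
  | succ i ih => rw [zpow_add_one]; exact ih.comp h
  | pred i ih => rw [zpow_sub_one]; exact ih.comp h'

theorem measurableEmbedding_zpow {σ : Equiv.Perm X} (h : MeasurePreserving σ μ μ)
    (h' : MeasurePreserving ⇑σ⁻¹ μ μ) (n : ℤ) : MeasurableEmbedding ⇑(σ ^ n) :=
  (MeasurableEquiv.mk (σ ^ n) (measurePreserving_zpow h h' n).measurable
    (by
      have := (measurePreserving_zpow h h' (-n)).measurable
      rwa [zpow_neg] at this)).measurableEmbedding

/-- Here `X n` stands for `T ^ n` applied to the indicator of `A`, divided by `r ^ n`, and `Y n` for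
the same with the adjoint. The cocycles define both for negative `n` without inverting `T`. `X n`
lives on the preimage of `A` under `σ ^ n`, so `Y 0` kills it whenever `A` does not return to itself
at time `n`. -/
theorem hasNontrivialHyperinvariantSubspace_of_wandering [IsProbabilityMeasure μ]
    {p : ℝ≥0∞} [Fact (1 ≤ p)] {σ : Equiv.Perm X} (hσ : MeasurePreserving σ μ μ)
    (hσ' : MeasurePreserving ⇑σ⁻¹ μ μ) {v : X → ℂ} (hv : Measurable v)
    {T : Lp ℂ p μ →L[ℂ] Lp ℂ p μ}
    (hT : ∀ f, (T f : X → ℂ) =ᵐ[μ] fun x => v x * (f : X → ℂ) (σ x))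
    {r : ℂ} (hr : r ≠ 0) {A : Set X} (hA : MeasurableSet A) (hμA : μ A ≠ 0)
    (hvA : ∀ x ∈ A, ∀ k : ℤ, v ((σ ^ k) x) ≠ 0) {ρ : ℤ → ℝ} (hρ : ∀ n, 0 ≤ ρ n)
    (hF : ∀ x ∈ A, ∀ n, ‖cocycle (fun k => v ((σ ^ (-k - 1)) x) / r) n‖ ≤ ρ n)
    (hG : ∀ x ∈ A, ∀ n, ‖cocycle (fun k => v ((σ ^ k) x) / r) n‖ ≤ ρ n)
    {a : ℤ → ℝ} (ha : Summable fun n => |a n| * ρ n) {Φ : Finset ℤ} (h0 : 0 ∈ Φ)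
    (hΦ : ∀ n ∈ Φ, n ≠ 0 → ∀ x ∈ A, (σ ^ n) x ∉ A)
    (htail : ∑' n : {n // n ∉ Φ}, |a n| * ρ n < |a 0|)
    (hconv : ∀ k, ∑' n, (a n : ℂ) * ((-1) ^ (k - n) * (a (k - n) : ℂ)) = 0) :
    HasNontrivialHyperinvariantSubspace T := by
  have hmp := measurePreserving_zpow hσ hσ'
  let F : ℤ → X → ℂ := fun n =>
    A.indicator fun x => cocycle (fun k => v ((σ ^ (-k - 1)) x) / r) n
  let G : ℤ → X → ℂ := fun n => A.indicator fun x => cocycle (fun k => v ((σ ^ k) x) / r) n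
  have hFm : ∀ n, Measurable (F n) := fun n => (measurable_cocycle
    (fun k => (hv.comp (hmp _).measurable).div_const r) n).indicator hA
  have hGm : ∀ n, Measurable (G n) := fun n => (measurable_cocycle
    (fun k => (hv.comp (hmp _).measurable).div_const r) n).indicator hA
  have hFle : ∀ n x, ‖F n x‖ ≤ ρ n := by
    intro n x
    by_cases hx : x ∈ A
    · simpa only [F, indicator_of_mem hx] using hF x hx n
    · simpa only [F, indicator_of_notMem hx, norm_zero] using hρ n
  have hGle : ∀ n x, ‖G n x‖ ≤ ρ n := by
    intro n x
    by_cases hx : x ∈ A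
    · simpa only [G, indicator_of_mem hx] using hG x hx n
    · simpa only [G, indicator_of_notMem hx, norm_zero] using hρ n
  have hFrec : ∀ n x, r * F (n + 1) x = v ((σ ^ (-n - 1)) x) * F n x := by
    intro n x
    by_cases hx : x ∈ A
    · simp only [F, indicator_of_mem hx]
      rw [cocycle_add_one fun k => div_ne_zero (hvA x hx _) hr]
      field_simp
    · simp only [F, indicator_of_notMem hx, mul_zero]
  have hGrec : ∀ n x, r * G (n + 1) x = v ((σ ^ n) x) * G n x := by
    intro n x
    by_cases hx : x ∈ A
    · simp only [G, indicator_of_mem hx]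
      rw [cocycle_add_one fun k => div_ne_zero (hvA x hx _) hr]
      field_simp
    · simp only [G, indicator_of_notMem hx, mul_zero]
  have hXmem : ∀ n, MemLp (F n ∘ ⇑(σ ^ n)) p μ := fun n =>
    MemLp.of_bound ((hFm n).comp (hmp n).measurable).aestronglyMeasurable (ρ n)
      (ae_of_all _ fun x => hFle n _)
  let Xs : ℤ → Lp ℂ p μ := fun n => (hXmem n).toLp
  have hXs : ∀ n, ‖Xs n‖ ≤ ρ n := by
    intro n
    have := Lp.norm_le_of_ae_bound (f := Xs n) (hρ n) (by
      filter_upwards [(hXmem n).coeFn_toLp] with x hx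
      simp only [Xs]
      rw [hx]; exact hFle n _)
    have h1 : measureUnivNNReal μ = 1 := by simp [measureUnivNNReal]
    simpa [h1] using this
  have hYex := fun n : ℤ => exists_integralFunctional (μ := μ) (p := p)
    ((hGm n).comp (hmp (-n)).measurable) (hρ n) fun x => hGle n _
  choose Y hY hYn using hYex
  have hTX : ∀ n, T (Xs n) = r • Xs (n + 1) := by
    intro n
    refine Lp.ext ?_
    filter_upwards [hT (Xs n), Lp.coeFn_smul r (Xs (n + 1)), (hXmem (n + 1)).coeFn_toLp,
      hσ.quasiMeasurePreserving.ae_eq_comp (hXmem n).coeFn_toLp] with x h1 h2 h3 h4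
    simp only [Function.comp_apply] at h3 h4
    rw [h1, h2, Pi.smul_apply, h3, h4, smul_eq_mul, hFrec, ← Equiv.Perm.mul_apply,
      ← Equiv.Perm.mul_apply, ← zpow_add, ← zpow_add_one]
    have : -n - 1 + (n + 1) = 0 := by ring
    rw [this, zpow_zero, Equiv.Perm.one_apply]
  have hYT : ∀ n f, Y n (T f) = r * Y (n + 1) f := by
    intro n f
    rw [hY, hY, ← integral_const_mul]
    -- Write the integrand as a function of `σ x`, so that invariance of the measure moves the
    -- composition from `f` to the kernel.
    have e1 : ∫ x, (G n ∘ ⇑(σ ^ (-n))) x * (T f : X → ℂ) x ∂μ =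
        ∫ x, (fun z => G n ((σ ^ (-n - 1)) z) * (v (σ⁻¹ z) * (f : X → ℂ) z)) (σ x) ∂μ := by
      refine integral_congr_ae ?_
      filter_upwards [hT f] with x hx
      rw [hx]
      have h0 : σ⁻¹ (σ x) = x := σ.symm_apply_apply x
      simp only [Function.comp_apply, h0]
      rw [← Equiv.Perm.mul_apply, ← zpow_add_one, sub_add_cancel]
    have hemb : MeasurableEmbedding ⇑σ := by simpa using measurableEmbedding_zpow hσ hσ' 1
    refine e1.trans ((hσ.integral_comp hemb fun z =>
      G n ((σ ^ (-n - 1)) z) * (v (σ⁻¹ z) * (f : X → ℂ) z)).trans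
        (integral_congr_ae (ae_of_all _ fun z => ?_)))
    simp only [Function.comp_apply]
    rw [← mul_assoc r, hGrec, ← Equiv.Perm.mul_apply, ← zpow_add]
    have e2 : n + -(n + 1) = -1 := by ring
    have e3 : -n - 1 = -(n + 1) := by ring
    rw [e2, e3, zpow_neg_one]; ring
  have hL : ∀ n, Y 0 (Xs n) = ∫ x in A, F n ((σ ^ n) x) ∂μ := by
    intro n
    rw [hY, ← integral_indicator hA]
    refine integral_congr_ae ?_
    filter_upwards [(hXmem n).coeFn_toLp] with x hx
    simp only [Xs]
    rw [hx]
    by_cases hxA : x ∈ A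
    · simp [G, hxA, cocycle_zero]
    · simp [G, hxA]
  have hμpos : 0 < μ.real A := ENNReal.toReal_pos hμA (measure_ne_top μ A)
  have hL0 : Y 0 (Xs 0) = μ.real A := by
    rw [hL, setIntegral_congr_fun (g := fun _ => (1 : ℂ)) hA]
    · simp [Measure.real]
    · intro x hx
      simp [F, hx, cocycle_zero]
  have hLΦ : ∀ n ∈ Φ, n ≠ 0 → Y 0 (Xs n) = 0 := by
    intro n hn hn0
    rw [hL, setIntegral_congr_fun (g := fun _ => (0 : ℂ)) hA]
    · simp
    · intro x hx
      exact indicator_of_notMem (hΦ n hn hn0 x hx) _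
  have hLle : ∀ n, ‖Y 0 (Xs n)‖ ≤ ρ n * μ.real A := by
    intro n
    rw [hL]
    exact norm_setIntegral_le_of_norm_le_const (measure_lt_top μ A) fun x _ => hFle n _
  have key : ∀ b : ℤ → ℂ, (∀ n, ‖b n‖ = |a n|) → ∑' n, b n * Y 0 (Xs n) ≠ 0 := by
    intro b hb
    have hle : ∀ n, ‖b n * Y 0 (Xs n)‖ ≤ |a n| * ρ n * μ.real A := by
      intro n
      rw [norm_mul, hb, mul_assoc]
      gcongr
      exact hLle n
    have hs : Summable fun n => b n * Y 0 (Xs n) :=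
      Summable.of_norm_bounded (ha.mul_right _) hle
    -- Inside `Φ` only `n = 0` survives, contributing `b 0 * μ A`; the remaining tail is too small
    -- to cancel it.
    rw [← hs.sum_add_tsum_subtype_compl Φ, Finset.sum_eq_single_of_mem 0 h0
      (fun n hn hn0 => by rw [hLΦ n hn hn0, mul_zero]), hL0]
    intro h
    have h1 : ‖∑' n : {n // n ∉ Φ}, b n * Y 0 (Xs n)‖ ≤
        ∑' n : {n // n ∉ Φ}, |a n| * ρ n * μ.real A :=
      tsum_of_norm_bounded ((ha.mul_right (μ.real A)).subtype _).hasSum fun n => hle n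
    rw [tsum_mul_right] at h1
    have h2 : ‖∑' n : {n // n ∉ Φ}, b n * Y 0 (Xs n)‖ = |a 0| * μ.real A := by
      rw [← norm_neg, ← eq_neg_of_add_eq_zero_left h, norm_mul, hb, Complex.norm_real,
        Real.norm_of_nonneg hμpos.le]
    rw [h2] at h1
    exact absurd htail (not_lt.2 (le_of_mul_le_mul_right h1 hμpos))
  refine hasNontrivialHyperinvariantSubspace_of_convolution_eq_zero T hr Xs Y hTX hYT
    (fun n => (a n : ℂ)) (fun n => (-1) ^ n * (a n : ℂ)) ?_ ?_ hconv (key _ fun n => by simp)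
    (key _ fun n => by simp)
  · refine Summable.of_nonneg_of_le (fun _ => by positivity) (fun n => ?_) ha
    simp only [Complex.norm_real, Real.norm_eq_abs]
    gcongr
    exact hXs n
  · refine Summable.of_nonneg_of_le (fun _ => by positivity) (fun n => ?_) ha
    simp only [norm_mul, norm_zpow, norm_neg, norm_one, one_zpow, one_mul, Complex.norm_real,
      Real.norm_eq_abs]
    gcongr
    exact hYn n

end Wandering

/-! ### Birkhoff sums of `log ‖v‖` along orbits avoiding the zeros. -/

section OrbitSums

variable {v : unitInterval → ℂ} {l : ℕ} {C : ℝ} {s : Fin (l + 1) → ℝ}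
  {c : Fin (l + 1) → unitInterval}

theorem abs_sum_log_norm_sub_le (hC : 0 < C) (hs : ∀ i, 0 < s i)
    (hv : ∀ x, ‖v x‖ = C * ∏ i, |(x : ℝ) - c i| ^ s i) (N : ℕ) {ω : ℕ → unitInterval} {η : ℝ}
    (h0 : 0 < η) (h1 : η ≤ 1)
    (hω : ∀ j ∈ Finset.Icc 1 N, (ω j : ℝ) ≠ 1 ∧ ∀ i, η ≤ |(ω j : ℝ) - c i|) :
    |∑ j ∈ Finset.Icc 1 N, (Real.log ‖v (ω j)‖ - (Real.log C + ∑ i, s i * logMean (c i)))| ≤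
      (∑ i, s i) * (N * seqDiscrepancy N (fun j => (ω j : ℝ)) * Real.log (1 / η) + 2 * η * N) := by
  have e1 : ∑ j ∈ Finset.Icc 1 N,
      (Real.log ‖v (ω j)‖ - (Real.log C + ∑ i, s i * logMean (c i))) =
      ∑ i, s i * (∑ j ∈ Finset.Icc 1 N, Real.log (max |(ω j : ℝ) - c i| η) -
        N * logMean (c i)) := by
    have : ∀ j ∈ Finset.Icc 1 N,
        Real.log ‖v (ω j)‖ - (Real.log C + ∑ i, s i * logMean (c i)) =
          ∑ i, s i * (Real.log (max |(ω j : ℝ) - c i| η) - logMean (c i)) := by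
      intro j hj
      have hpos : ∀ i, 0 < |(ω j : ℝ) - c i| := fun i => h0.trans_le ((hω j hj).2 i)
      rw [hv, Real.log_mul hC.ne' (Finset.prod_ne_zero_iff.2 fun i _ =>
        (Real.rpow_pos_of_pos (hpos i) _).ne'), Real.log_prod fun i _ =>
        (Real.rpow_pos_of_pos (hpos i) _).ne', add_sub_add_left_eq_sub,
        ← Finset.sum_sub_distrib]
      refine Finset.sum_congr rfl fun i _ => ?_
      rw [Real.log_rpow (hpos i), max_eq_left ((hω j hj).2 i)]; ring
    rw [Finset.sum_congr rfl this, Finset.sum_comm]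
    refine Finset.sum_congr rfl fun i _ => ?_
    rw [← Finset.mul_sum, Finset.sum_sub_distrib]
    simp
  rw [e1, Finset.sum_mul]
  refine (Finset.abs_sum_le_sum_abs _ _).trans (Finset.sum_le_sum fun i _ => ?_)
  rw [abs_mul, abs_of_pos (hs i)]
  refine mul_le_mul_of_nonneg_left ?_ (hs i).le
  refine abs_sum_log_max_sub_le N (ω := fun j => (ω j : ℝ)) (fun j hj => ⟨(ω j).2.1, ?_⟩)
    (c i).2 h0 h1
  exact lt_of_le_of_ne (ω j).2.2 (hω j hj).1

/-- The two-sided orbit of `x` avoids the endpoint `1`, and approaches the points `c i` at most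
quadratically. -/
def OrbitAvoids (σ : Equiv.Perm unitInterval) (c : Fin (l + 1) → unitInterval) (δ : ℝ)
    (x : unitInterval) : Prop :=
  ∀ k : ℤ, (((σ ^ k) x : unitInterval) : ℝ) ≠ 1 ∧
    ∀ i, δ / ((k.natAbs : ℝ) + 1) ^ 2 ≤ |(((σ ^ k) x : unitInterval) : ℝ) - c i|

theorem sum_Icc_one_eq_sum_range {M : Type*} [AddCommMonoid M] (f : ℕ → M) (N : ℕ) :
    ∑ j ∈ Finset.Icc 1 N, f j = ∑ k ∈ Finset.range N, f (k + 1) := by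
  rw [Finset.range_eq_Ico, Finset.sum_Ico_add' f 0 N 1]
  rfl

/-- A bound for the deviation of the sums of `log ‖v‖` over orbit segments of length `N`. -/
noncomputable def orbitSumBound (S δ : ℝ) (D : ℕ → ℝ) (N : ℕ) : ℝ :=
  S * (N * D N * Real.log (((N : ℝ) + 1) ^ 2 / δ) + 2 * (δ / ((N : ℝ) + 1) ^ 2) * N)

/-- At times of modulus at most `N` the orbit stays at distance `δ / (N + 1) ^ 2` from the zeros, so
truncating at that `η` changes nothing. The discrepancy is uniform in the starting point, so the
same bound serves forward and backward segments. -/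
theorem OrbitAvoids.abs_sum_segment_le (hC : 0 < C) (hs : ∀ i, 0 < s i)
    (hv : ∀ x, ‖v x‖ = C * ∏ i, |(x : ℝ) - c i| ^ s i) {σ : Equiv.Perm unitInterval}
    {δ : ℝ} (h0 : 0 < δ) (h1 : δ ≤ 1) {x : unitInterval} (hx : OrbitAvoids σ c δ x) (N : ℕ)
    (m : ℤ) (hm : ∀ j ∈ Finset.Icc 1 N, ((j : ℤ) + m).natAbs ≤ N) :
    |∑ k ∈ Finset.range N, (Real.log ‖v ((σ ^ ((k : ℤ) + 1 + m)) x)‖ -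
      (Real.log C + ∑ i, s i * logMean (c i)))| ≤
        orbitSumBound (∑ i, s i) δ (mapDiscrepancy σ) N := by
  set z := (σ ^ m) x with hz
  have hit : ∀ j : ℕ, (⇑σ)^[j] z = (σ ^ ((j : ℤ) + m)) x := by
    intro j
    rw [Equiv.Perm.iterate_eq_pow, hz, ← zpow_natCast, ← Equiv.Perm.mul_apply, ← zpow_add]
  have hη0 : 0 < δ / ((N : ℝ) + 1) ^ 2 := by positivity
  have hη1 : δ / ((N : ℝ) + 1) ^ 2 ≤ 1 := by
    refine div_le_one_of_le₀ (h1.trans ?_) (by positivity)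
    exact one_le_pow₀ (by linarith [Nat.cast_nonneg (α := ℝ) N])
  have key := abs_sum_log_norm_sub_le hC hs hv N (ω := fun j => (⇑σ)^[j] z) hη0 hη1 (by
    intro j hj
    rw [hit]
    refine ⟨(hx _).1, fun i => le_trans ?_ ((hx _).2 i)⟩
    have : ((((j : ℤ) + m).natAbs : ℕ) : ℝ) ≤ N := by exact_mod_cast hm j hj
    gcongr)
  rw [sum_Icc_one_eq_sum_range] at key
  simp only [hit, Nat.cast_add, Nat.cast_one] at key
  refine key.trans ?_
  unfold orbitSumBound
  rw [one_div_div]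
  have hd : seqDiscrepancy N (fun j => (((σ ^ ((j : ℤ) + m)) x : unitInterval) : ℝ)) ≤
      mapDiscrepancy σ N := by
    have := seqDiscrepancy_le_mapDiscrepancy σ N (x := z) (lt_of_le_of_ne z.2.2 (hx m).1)
    simpa only [hit] using this
  have hl : 0 ≤ Real.log (((N : ℝ) + 1) ^ 2 / δ) := by
    rw [← one_div_div]
    exact Real.log_nonneg (one_le_one_div hη0 hη1)
  have hS : 0 ≤ ∑ i, s i := Finset.sum_nonneg fun i _ => (hs i).le
  gcongr

theorem OrbitAvoids.abs_sum_range_le (hC : 0 < C) (hs : ∀ i, 0 < s i)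
    (hv : ∀ x, ‖v x‖ = C * ∏ i, |(x : ℝ) - c i| ^ s i) {σ : Equiv.Perm unitInterval}
    {δ : ℝ} (h0 : 0 < δ) (h1 : δ ≤ 1) {x : unitInterval} (hx : OrbitAvoids σ c δ x) (N : ℕ) :
    |∑ k ∈ Finset.range N, (Real.log ‖v ((σ ^ (k : ℤ)) x)‖ -
      (Real.log C + ∑ i, s i * logMean (c i)))| ≤
        orbitSumBound (∑ i, s i) δ (mapDiscrepancy σ) N := by
  have := hx.abs_sum_segment_le hC hs hv h0 h1 N (-1) (by
    intro j hj; rw [Finset.mem_Icc] at hj; omega)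
  simpa using this

theorem OrbitAvoids.abs_sum_range_neg_le (hC : 0 < C) (hs : ∀ i, 0 < s i)
    (hv : ∀ x, ‖v x‖ = C * ∏ i, |(x : ℝ) - c i| ^ s i) {σ : Equiv.Perm unitInterval}
    {δ : ℝ} (h0 : 0 < δ) (h1 : δ ≤ 1) {x : unitInterval} (hx : OrbitAvoids σ c δ x) (N : ℕ) :
    |∑ k ∈ Finset.range N, (Real.log ‖v ((σ ^ (-((k : ℤ) + 1))) x)‖ -
      (Real.log C + ∑ i, s i * logMean (c i)))| ≤
        orbitSumBound (∑ i, s i) δ (mapDiscrepancy σ) N := by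
  -- The segment runs over the times `-N, …, -1`; reflecting the sum lists them backwards.
  have := hx.abs_sum_segment_le hC hs hv h0 h1 N (-N - 1) (by
    intro j hj; rw [Finset.mem_Icc] at hj; omega)
  rw [← Finset.sum_range_reflect] at this
  convert this using 7 with k hk
  rw [Finset.mem_range] at hk
  congr 2
  omega

theorem OrbitAvoids.ne_zero (hC : 0 < C)
    (hv : ∀ x, ‖v x‖ = C * ∏ i, |(x : ℝ) - c i| ^ s i) {σ : Equiv.Perm unitInterval}
    {δ : ℝ} (h0 : 0 < δ) {x : unitInterval} (hx : OrbitAvoids σ c δ x) (k : ℤ) :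
    v ((σ ^ k) x) ≠ 0 := by
  rw [← norm_pos_iff, hv]
  refine mul_pos hC (Finset.prod_pos fun i _ => Real.rpow_pos_of_pos ?_ _)
  exact lt_of_lt_of_le (by positivity) ((hx k).2 i)

theorem volume_abs_sub_lt_le (c : unitInterval) (η : ℝ) :
    volume {t : unitInterval | |(t : ℝ) - c| < η} ≤ ENNReal.ofReal (2 * η) := by
  have h1 : volume {t : unitInterval | |(t : ℝ) - c| < η} =
      volume (Subtype.val '' {t : unitInterval | |(t : ℝ) - c| < η}) :=
    (MeasurableEmbedding.subtype_coe measurableSet_Icc).comap_apply _ _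
  have h2 : Subtype.val '' {t : unitInterval | |(t : ℝ) - c| < η} ⊆
      Ioo ((c : ℝ) - η) (c + η) := by
    rintro _ ⟨t, ht, rfl⟩
    have := abs_lt.1 (show |(t : ℝ) - c| < η from ht)
    constructor <;> linarith [this.1, this.2]
  rw [h1]
  refine (measure_mono h2).trans ?_
  rw [Real.volume_Ioo]
  exact ENNReal.ofReal_le_ofReal (by linarith)

theorem measurableSet_orbitAvoids {σ : Equiv.Perm unitInterval}
    (hσ : ∀ n : ℤ, Measurable ⇑(σ ^ n)) (c : Fin (l + 1) → unitInterval) (δ : ℝ) :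
    MeasurableSet {x | OrbitAvoids σ c δ x} := by
  have : {x | OrbitAvoids σ c δ x} = ⋂ k : ℤ, ({x | (((σ ^ k) x : unitInterval) : ℝ) = 1}ᶜ ∩
      ⋂ i, {x | δ / ((k.natAbs : ℝ) + 1) ^ 2 ≤ |(((σ ^ k) x : unitInterval) : ℝ) - c i|}) := by
    ext x
    simp [OrbitAvoids]
  rw [this]
  have hm : ∀ k : ℤ, Measurable fun x => (((σ ^ k) x : unitInterval) : ℝ) := fun k =>
    measurable_subtype_coe.comp (hσ k)
  refine MeasurableSet.iInter fun k => (measurableSet_eq_fun (hm k) measurable_const).compl.inter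
    (MeasurableSet.iInter fun i => measurableSet_le measurable_const ?_)
  have := ((hm k).sub_const ((c i : unitInterval) : ℝ)).norm
  simpa only [Real.norm_eq_abs] using this

/-- Borel–Cantelli: the bad sets at time `k` have total measure at most `2 * (l + 1) * δ / (|k| + 1)
^ 2`, which is summable in `k`. The choice of `δ` makes the total at most `1/2`. -/
theorem exists_volume_orbitAvoids_ne_zero {σ : Equiv.Perm unitInterval}
    (hσ : ∀ n : ℤ, MeasurePreserving ⇑(σ ^ n) (volume : Measure unitInterval) volume)
    (c : Fin (l + 1) → unitInterval) :
    ∃ δ : ℝ, 0 < δ ∧ δ ≤ 1 ∧ volume {x | OrbitAvoids σ c δ x} ≠ 0 := by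
  let u : ℤ → ℝ := fun k => 1 / ((k.natAbs : ℝ) + 1) ^ 2
  have hu : Summable u := by
    have h1 : Summable fun n : ℤ => 1 / (n : ℝ) ^ 2 :=
      Real.summable_one_div_int_pow.2 (by norm_num)
    refine Summable.of_norm_bounded_eventually h1 ?_
    filter_upwards [Set.Finite.compl_mem_cofinite (finite_singleton (0 : ℤ))] with n hn
    have hn0 : n ≠ 0 := by simpa using hn
    have hpos : (0 : ℝ) < |(n : ℝ)| := abs_pos.2 (by exact_mod_cast hn0)
    rw [Real.norm_of_nonneg (by positivity), ← sq_abs (n : ℝ)]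
    simp only [u]
    rw [Nat.cast_natAbs, Int.cast_abs]
    gcongr
    linarith
  have hu0 : ∀ k, 0 ≤ u k := fun k => by positivity
  set K := ∑' k, u k with hK
  have hK1 : 1 ≤ K := by
    have := hu.le_tsum 0 fun k _ => hu0 k
    have h00 : u 0 = 1 := by simp [u]
    rwa [h00] at this
  have hl : (0 : ℝ) < l + 1 := by positivity
  set δ : ℝ := 1 / (4 * (l + 1) * K) with hδ
  have hδ0 : 0 < δ := by positivity
  have hδ1 : δ ≤ 1 := by
    rw [hδ, div_le_one (by positivity)]
    have : (1 : ℝ) ≤ l + 1 := by linarith [Nat.cast_nonneg (α := ℝ) l]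
    nlinarith
  refine ⟨δ, hδ0, hδ1, fun hnull => ?_⟩
  have hsub : (univ : Set unitInterval) ⊆ {x | OrbitAvoids σ c δ x} ∪
      ((⋃ k : ℤ, ⇑(σ ^ k) ⁻¹' {1}) ∪
        ⋃ k : ℤ, ⋃ i, ⇑(σ ^ k) ⁻¹' {t : unitInterval | |(t : ℝ) - c i| < δ * u k}) := by
    intro x _
    by_cases hx : OrbitAvoids σ c δ x
    · exact Or.inl hx
    · right
      unfold OrbitAvoids at hx
      push Not at hx
      obtain ⟨k, hk⟩ := hx
      by_cases h1 : (((σ ^ k) x : unitInterval) : ℝ) = 1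
      · left
        exact mem_iUnion.2 ⟨k, Subtype.ext h1⟩
      · right
        obtain ⟨i, hi⟩ := hk h1
        refine mem_iUnion.2 ⟨k, mem_iUnion.2 ⟨i, ?_⟩⟩
        simpa only [u, mem_preimage, mem_ofPred_eq, mul_one_div] using hi
  have hz : volume (⋃ k : ℤ, ⇑(σ ^ k) ⁻¹' ({1} : Set unitInterval)) = 0 := by
    refine measure_iUnion_null fun k => ?_
    rw [(hσ k).measure_preimage (measurableSet_singleton _).nullMeasurableSet]
    exact measure_singleton _
  have hb : volume (⋃ k : ℤ, ⋃ i, ⇑(σ ^ k) ⁻¹' {t : unitInterval | |(t : ℝ) - c i| < δ * u k}) ≤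
      ENNReal.ofReal (1 / 2) := by
    calc _ ≤ ∑' k : ℤ, ∑ _i : Fin (l + 1), ENNReal.ofReal (2 * (δ * u k)) := by
          refine (measure_iUnion_le _).trans (ENNReal.tsum_le_tsum fun k => ?_)
          refine (measure_iUnion_fintype_le _ _).trans (Finset.sum_le_sum fun i _ => ?_)
          have hms : MeasurableSet {t : unitInterval | |(t : ℝ) - c i| < δ * u k} := by
            refine (isOpen_lt ?_ continuous_const).measurableSet
            fun_prop
          rw [(hσ k).measure_preimage hms.nullMeasurableSet]
          exact volume_abs_sub_lt_le _ _
      _ = ∑' k : ℤ, ENNReal.ofReal ((l + 1) * (2 * (δ * u k))) := by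
          refine tsum_congr fun k => ?_
          rw [Finset.sum_const, Finset.card_univ, Fintype.card_fin, nsmul_eq_mul,
            ENNReal.ofReal_mul hl.le]
          congr 1
          rw [← Nat.cast_succ, ENNReal.ofReal_natCast]
      _ = ENNReal.ofReal (∑' k : ℤ, (l + 1) * (2 * (δ * u k))) := by
          rw [ENNReal.ofReal_tsum_of_nonneg (fun k => by have := hu0 k; positivity)
            (((hu.mul_left _).mul_left _).mul_left _)]
      _ = _ := by
          congr 1
          rw [tsum_mul_left, tsum_mul_left, tsum_mul_left, ← hK, hδ]
          field_simp
          norm_num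
  have h1 : (1 : ℝ≥0∞) ≤ ENNReal.ofReal (1 / 2) := by
    calc (1 : ℝ≥0∞) = volume (univ : Set unitInterval) := measure_univ.symm
      _ ≤ 0 + (0 + ENNReal.ofReal (1 / 2)) := by
          refine (measure_mono hsub).trans ((measure_union_le _ _).trans ?_)
          refine add_le_add hnull.le ((measure_union_le _ _).trans (add_le_add hz.le hb))
      _ = _ := by simp
  rw [← ENNReal.ofReal_one, ENNReal.ofReal_le_ofReal_iff (by norm_num)] at h1
  norm_num at h1

end OrbitSums

/-! ### Aperiodicity and sets with no returns at finitely many times. -/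

section Aperiodic

/-- Each point of `B` differs from its finitely many images, so some basic open `U` contains it and
none of them. Countably many pieces `A U` therefore cover `B`, and one has nonzero measure. -/
theorem exists_wandering_subset {X : Type*} [TopologicalSpace X] [SecondCountableTopology X]
    [T1Space X] [MeasurableSpace X] [BorelSpace X] {μ : Measure X} {σ : Equiv.Perm X}
    (hσ : ∀ n : ℤ, Measurable ⇑(σ ^ n)) {B : Set X} (hB : MeasurableSet B) (hμB : μ B ≠ 0)
    (hper : ∀ x ∈ B, ∀ n : ℤ, n ≠ 0 → (σ ^ n) x ≠ x) (Φ : Finset ℤ) :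
    ∃ A ⊆ B, MeasurableSet A ∧ μ A ≠ 0 ∧ ∀ n ∈ Φ, n ≠ 0 → ∀ x ∈ A, (σ ^ n) x ∉ A := by
  let b := TopologicalSpace.countableBasis X
  let A : Set X → Set X := fun U => B ∩ U ∩ ⋂ n ∈ Φ.erase 0, ⇑(σ ^ n) ⁻¹' Uᶜ
  by_contra! hcon
  have hopen : ∀ U ∈ b, IsOpen U := fun U hU => TopologicalSpace.isOpen_of_mem_countableBasis hU
  have hA0 : ∀ U ∈ b, μ (A U) = 0 := by
    intro U hU
    by_contra hne
    have hUm := (hopen U hU).measurableSet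
    obtain ⟨n, hn, hn0, x, hx, hx'⟩ := hcon (A U) (fun x hx => hx.1.1)
      ((hB.inter hUm).inter (Finset.measurableSet_biInter _ fun n _ => hσ n hUm.compl)) hne
    have := mem_iInter₂.1 hx.2 n (Finset.mem_erase.2 ⟨hn0, hn⟩)
    exact this hx'.1.2
  have hcover : B ⊆ ⋃ U ∈ b, A U := by
    intro x hx
    let F : Set X := (fun n : ℤ => (σ ^ n) x) '' (Φ.erase 0 : Finset ℤ)
    have hF : IsOpen Fᶜ := ((Finset.finite_toSet _).image _).isClosed.isOpen_compl
    have hxF : x ∈ Fᶜ := by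
      intro h
      obtain ⟨n, hn, hnx⟩ := h
      exact hper x hx n (Finset.mem_erase.1 (Finset.mem_coe.1 hn)).1 hnx
    obtain ⟨U, hU, hxU, hUF⟩ :=
      (TopologicalSpace.isBasis_countableBasis X).exists_subset_of_mem_open hxF hF
    refine mem_iUnion₂.2 ⟨U, hU, ⟨hx, hxU⟩, mem_iInter₂.2 fun n hn hmem => ?_⟩
    exact hUF hmem (mem_image_of_mem _ (Finset.mem_coe.2 hn))
  refine hμB (measure_mono_null hcover ?_)
  exact (measure_biUnion_null_iff (TopologicalSpace.countable_countableBasis X)).2 hA0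

/-- The orbit visits `x` with frequency at least `1 / m`, whereas an interval starting at `x` can be
chosen of length at most `1 / (2 * m)`. -/
theorem one_div_two_mul_le_seqDiscrepancy {τ : unitInterval → unitInterval} {x : unitInterval}
    (hx : (x : ℝ) < 1) {m : ℕ} (hm : 0 < m) (hper : τ^[m] x = x) {q : ℕ} (hq : 0 < q) :
    1 / (2 * (m : ℝ)) ≤ seqDiscrepancy (m * q) (fun n => ((τ^[n] x : unitInterval) : ℝ)) := by
  have hm' : (0 : ℝ) < m := by exact_mod_cast hm
  have hq' : (0 : ℝ) < q := by exact_mod_cast hq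
  set κ : ℝ := min (1 - x) (1 / (2 * (m : ℝ))) with hκ
  have hκ0 : 0 < κ := lt_min (by linarith) (by positivity)
  have hκ1 : κ ≤ 1 - x := min_le_left _ _
  have hκ2 : κ ≤ 1 / (2 * (m : ℝ)) := min_le_right _ _
  have h := abs_countIn_div_sub_le (m * q) (fun n => ((τ^[n] x : unitInterval) : ℝ)) x.2.1
    (lt_add_of_pos_right (x : ℝ) hκ0) (by linarith)
  have hcount : q ≤ countIn (m * q) (Ico (x : ℝ) (x + κ))
      (fun n => ((τ^[n] x : unitInterval) : ℝ)) := by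
    classical
    have : ((Finset.Icc 1 q).image fun j => m * j).card = q := by
      rw [Finset.card_image_of_injective _ (fun a b h => Nat.eq_of_mul_eq_mul_left hm h), Nat.card_Icc]
      simp
    refine this.ge.trans ?_
    unfold countIn
    refine Finset.card_le_card fun n hn => ?_
    obtain ⟨j, hj, rfl⟩ := Finset.mem_image.1 hn
    rw [Finset.mem_Icc] at hj
    have hfix : τ^[m * j] x = x := by
      rw [Function.iterate_mul]
      exact Function.iterate_fixed hper j
    simp only [Finset.mem_filter, Finset.mem_Icc, hfix, mem_Ico]
    refine ⟨⟨Nat.mul_pos hm hj.1, Nat.mul_le_mul_left m hj.2⟩, le_rfl, by linarith⟩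
  have h2 : 1 / (m : ℝ) ≤ (countIn (m * q) (Ico (x : ℝ) (x + κ))
      (fun n => ((τ^[n] x : unitInterval) : ℝ)) : ℝ) / ((m * q : ℕ) : ℝ) := by
    rw [Nat.cast_mul, div_le_div_iff₀ hm' (by positivity), one_mul, mul_comm]
    gcongr
  have h3 : 1 / (m : ℝ) = 1 / (2 * (m : ℝ)) + 1 / (2 * (m : ℝ)) := by field_simp; norm_num
  have h4 := (le_abs_self _).trans h
  linarith

theorem zpow_apply_ne_of_mapDiscrepancy_tendsto {σ : Equiv.Perm unitInterval}
    (hD : Filter.Tendsto (mapDiscrepancy σ) Filter.atTop (nhds 0)) {x : unitInterval}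
    (hx : (x : ℝ) < 1) {n : ℤ} (hn : n ≠ 0) : (σ ^ n) x ≠ x := by
  intro h
  have hm : 0 < n.natAbs := Int.natAbs_pos.2 hn
  have hper : (⇑σ)^[n.natAbs] x = x := by
    rw [Equiv.Perm.iterate_eq_pow, ← zpow_natCast]
    rcases Int.natAbs_eq n with h' | h'
    · rw [← h']; exact h
    · have : ((n.natAbs : ℕ) : ℤ) = -n := by omega
      rw [this, zpow_neg, Equiv.Perm.inv_eq_iff_eq]
      exact h.symm
  have hlim := hD.comp (Filter.tendsto_id.const_mul_atTop' hm)
  have hpos : (0 : ℝ) < 1 / (2 * (n.natAbs : ℝ)) := by positivity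
  obtain ⟨q, hq, hq0⟩ := ((hlim.eventually_lt_const hpos).and
    (Filter.eventually_gt_atTop 0)).exists
  have h1 := one_div_two_mul_le_seqDiscrepancy hx hm hper hq0
  have h2 := seqDiscrepancy_le_mapDiscrepancy σ (n.natAbs * q) hx
  exact absurd hq (not_lt.2 (h1.trans h2))

end Aperiodic

/-! ### Dyadic form of the growth bound. -/

section Growth

theorem exists_le_div_log_pow {D : ℕ → ℝ} {ε : ℝ} (hε : 0 < ε)
    (hD : D =O[Filter.atTop] fun n : ℕ => 1 / (Real.log (n : ℝ)) ^ (3 + ε)) :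
    ∃ K : ℝ, 0 ≤ K ∧ ∃ N₀ : ℕ, ∀ N ≥ N₀, D N ≤ K / Real.log N ^ 3 := by
  obtain ⟨K, hK, hb⟩ := hD.exists_nonneg
  rw [Asymptotics.isBigOWith_iff] at hb
  have hlog : ∀ᶠ N : ℕ in Filter.atTop, 1 ≤ Real.log (N : ℝ) :=
    (Real.tendsto_log_atTop.comp tendsto_natCast_atTop_atTop).eventually_ge_atTop 1
  obtain ⟨N₀, hN₀⟩ := Filter.eventually_atTop.1 (hb.and hlog)
  refine ⟨K, hK, N₀, fun N hN => ?_⟩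
  obtain ⟨h1, h2⟩ := hN₀ N hN
  have hp : Real.log (N : ℝ) ^ 3 ≤ Real.log (N : ℝ) ^ (3 + ε) := by
    rw [← Real.rpow_natCast]
    exact Real.rpow_le_rpow_of_exponent_le h2 (by push_cast; linarith)
  have hpos : 0 < Real.log (N : ℝ) ^ 3 := by positivity
  calc D N ≤ K * ‖1 / Real.log (N : ℝ) ^ (3 + ε)‖ := (le_abs_self _).trans h1
    _ = K * (1 / Real.log (N : ℝ) ^ (3 + ε)) := by rw [Real.norm_of_nonneg (by positivity)]
    _ ≤ K * (1 / Real.log (N : ℝ) ^ 3) := by gcongr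
    _ = _ := by ring

/-- A majorant of `orbitSumBound` on the dyadic block `[2 ^ m, 2 ^ (m + 1))`. -/
noncomputable def dyadicBound (S K L : ℝ) (m : ℕ) : ℝ :=
  S * (16 * K * (4 + L)) * (2 ^ m / m ^ 2) + 2 * S

theorem summable_dyadicBound_div (S K L : ℝ) : Summable fun m => dyadicBound S K L m / 2 ^ m := by
  have h1 : Summable fun m : ℕ => S * (16 * K * (4 + L)) * (1 / (m : ℝ) ^ 2) :=
    (Real.summable_one_div_nat_pow.2 (by norm_num)).mul_left _
  have h2 : Summable fun m : ℕ => 2 * S * (1 / 2 : ℝ) ^ m := summable_geometric_two.mul_left _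
  refine (h1.add h2).congr fun m => ?_
  unfold dyadicBound
  rw [add_div, div_pow, one_pow]
  have : (2 : ℝ) ^ m ≠ 0 := by positivity
  field_simp

theorem dyadicBound_nonneg {S K L : ℝ} (hS : 0 ≤ S) (hK : 0 ≤ K) (hL : 0 ≤ L) (m : ℕ) :
    0 ≤ dyadicBound S K L m := by
  unfold dyadicBound; positivity

/-- On the block `log N` is comparable to `m`. One of the three logarithms in the discrepancy bound
pays for the truncation at `η`, leaving `2 ^ m / m ^ 2`. -/
theorem orbitSumBound_le_dyadicBound {S K δ : ℝ} (hS : 0 ≤ S) (hK : 0 ≤ K) (h0 : 0 < δ)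
    (h1 : δ ≤ 1) {D : ℕ → ℝ} {N m : ℕ} (hD : D N ≤ K / Real.log N ^ 3) (hm : 1 ≤ m)
    (hN : 2 ^ m ≤ N) (hN' : N < 2 ^ (m + 1)) :
    orbitSumBound S δ D N ≤ dyadicBound S K (Real.log (1 / δ)) m := by
  set L := Real.log (1 / δ) with hLdef
  have hL : 0 ≤ L := Real.log_nonneg (one_le_one_div h0 h1)
  have hm' : (1 : ℝ) ≤ m := by exact_mod_cast hm
  have hNr : (2 : ℝ) ^ m ≤ N := by exact_mod_cast hN
  have hNr' : (N : ℝ) + 1 ≤ 2 ^ (m + 1) := by exact_mod_cast hN'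
  have hNpos : (0 : ℝ) < N := lt_of_lt_of_le (by positivity) hNr
  have hlog : (m : ℝ) / 2 ≤ Real.log N := by
    have := Real.log_le_log (by positivity) hNr
    rw [Real.log_pow] at this
    nlinarith [Real.log_two_gt_d9]
  have hlog' : Real.log ((N : ℝ) + 1) ≤ 2 * m := by
    have := Real.log_le_log (by positivity) hNr'
    rw [Real.log_pow] at this
    push_cast at this
    nlinarith [Real.log_two_lt_d9]
  have hDN : D N ≤ 8 * K / m ^ 3 := by
    refine hD.trans ?_
    calc K / Real.log N ^ 3 ≤ K / ((m : ℝ) / 2) ^ 3 := by gcongr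
      _ = _ := by field_simp; ring
  have hl : Real.log (((N : ℝ) + 1) ^ 2 / δ) ≤ (4 + L) * m := by
    rw [div_eq_mul_one_div, Real.log_mul (by positivity) (by positivity), Real.log_pow, ← hLdef]
    push_cast
    nlinarith
  have hl0 : 0 ≤ Real.log (((N : ℝ) + 1) ^ 2 / δ) := by
    refine Real.log_nonneg ((one_le_div h0).2 (h1.trans (one_le_pow₀ (by linarith))))
  have hlast : 2 * (δ / ((N : ℝ) + 1) ^ 2) * N ≤ 2 := by
    have : δ / ((N : ℝ) + 1) ^ 2 * N ≤ 1 := by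
      rw [div_mul_eq_mul_div, div_le_one (by positivity)]
      nlinarith
    linarith
  have hfirst : N * D N * Real.log (((N : ℝ) + 1) ^ 2 / δ) ≤
      16 * K * (4 + L) * (2 ^ m / m ^ 2) := by
    calc N * D N * Real.log (((N : ℝ) + 1) ^ 2 / δ)
        ≤ 2 ^ (m + 1) * (8 * K / m ^ 3) * ((4 + L) * m) := by
          refine mul_le_mul ?_ hl hl0 (by positivity)
          refine (mul_le_mul_of_nonneg_left hDN hNpos.le).trans ?_
          gcongr
          linarith
      _ = _ := by field_simp; ring
  unfold orbitSumBound dyadicBound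
  calc _ ≤ S * (16 * K * (4 + L) * (2 ^ m / m ^ 2) + 2) := by gcongr
    _ = _ := by ring

end Growth

/-! ### Choice of the parameters and conclusion. -/

theorem theorem1 (p : ℝ≥0∞) [Fact (1 ≤ p)]
    (τ : unitInterval → unitInterval) (hbij : Function.Bijective τ)
    (herg : Ergodic τ (volume : Measure unitInterval))
    (v : unitInterval → ℂ) (hv : IsGeneralizedPolynomial v)
    (ε : ℝ) (hε : 0 < ε)
    (hD : (fun n : ℕ => mapDiscrepancy τ n) =O[Filter.atTop]
      fun n : ℕ => 1 / (Real.log (n : ℝ)) ^ (3 + ε)) :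
    ∃ T : Lp ℂ p (volume : Measure unitInterval) →L[ℂ] Lp ℂ p (volume : Measure unitInterval),
      IsWeightedComposition p v τ T ∧ HasNontrivialHyperinvariantSubspace T := by
  obtain ⟨hvm, l, C, s, c, hC, hs, hvn⟩ := hv.exists_norm_eq
  let σ : Equiv.Perm unitInterval := Equiv.ofBijective τ hbij
  have hσ : MeasurePreserving ⇑σ (volume : Measure unitInterval) volume := herg.toMeasurePreserving
  have hσ' : MeasurePreserving ⇑σ⁻¹ (volume : Measure unitInterval) volume := by
    -- An injective Borel map between standard Borel spaces is a measurable embedding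
    -- (Lusin–Souslin), so the inverse is Borel.
    have hemb : MeasurableEmbedding ⇑σ := hσ.measurable.measurableEmbedding σ.injective
    have hinv : Measurable ⇑σ.symm := by
      intro t ht
      rw [← σ.image_eq_preimage_symm]
      exact hemb.measurableSet_image.2 ht
    exact hσ.symm (MeasurableEquiv.mk σ hσ.measurable hinv)
  have hmp := measurePreserving_zpow hσ hσ'
  have hvbdd : ∀ x, ‖v x‖ ≤ C := by
    intro x
    rw [hvn]
    refine mul_le_of_le_one_right hC.le (Finset.prod_le_one (fun i _ => by positivity) fun i _ =>
      Real.rpow_le_one (abs_nonneg _) ?_ (hs i).le)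
    rw [abs_le]
    constructor <;> linarith [x.2.1, x.2.2, (c i).2.1, (c i).2.2]
  obtain ⟨T, hT⟩ := exists_weightedComposition (p := p) hσ hvm hvbdd
  refine ⟨T, hT, ?_⟩
  obtain ⟨K, hK, N₀, hDK⟩ := exists_le_div_log_pow hε hD
  have hD0 : Filter.Tendsto (mapDiscrepancy σ) Filter.atTop (nhds 0) := by
    refine hD.trans_tendsto ?_
    have h1 := (Real.tendsto_log_atTop.comp (tendsto_natCast_atTop_atTop (R := ℝ)))
    have h2 := (tendsto_rpow_atTop (by linarith : 0 < 3 + ε)).comp h1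
    simp_rw [one_div]
    exact h2.inv_tendsto_atTop
  obtain ⟨δ, hδ0, hδ1, hB⟩ := exists_volume_orbitAvoids_ne_zero hmp c
  have hBm := measurableSet_orbitAvoids (fun n => (hmp n).measurable) c δ
  set S := ∑ i, s i with hS
  have hS0 : 0 ≤ S := Finset.sum_nonneg fun i _ => (hs i).le
  set κ := Real.log C + ∑ i, s i * logMean (c i) with hκ
  set E : ℕ → ℝ := orbitSumBound S δ (mapDiscrepancy σ) with hE
  set L := Real.log (1 / δ) with hLdef
  have hL : 0 ≤ L := Real.log_nonneg (one_le_one_div hδ0 hδ1)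
  obtain ⟨a, ha0, ⟨m₀, ham⟩, hconv⟩ := exists_convolution_eq_zero_of_summable
    (summable_dyadicBound_div S K L) (dyadicBound_nonneg hS0 hK hL)
  let ρ : ℤ → ℝ := fun n => Real.exp (E n.natAbs)
  have hρ : ∀ n, 0 ≤ ρ n := fun n => (Real.exp_pos _).le
  have hsum : Summable fun n => |a n| * ρ n := by
    have h1 : Summable fun n : ℤ => 4 * (1 / (n : ℝ) ^ 2) :=
      (Real.summable_one_div_int_pow.2 (by norm_num)).mul_left 4
    refine Summable.of_norm_bounded_eventually h1 ?_
    have hfin : {n : ℤ | n.natAbs < max N₀ (2 ^ (m₀ + 1))}.Finite := by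
      refine (finite_Icc (-(max N₀ (2 ^ (m₀ + 1)) : ℕ) : ℤ) (max N₀ (2 ^ (m₀ + 1)) : ℕ)).subset ?_
      intro n hn
      have hn' : n.natAbs < max N₀ (2 ^ (m₀ + 1)) := hn
      rw [mem_Icc]
      omega
    filter_upwards [hfin.compl_mem_cofinite] with n hn
    have hn' : max N₀ (2 ^ (m₀ + 1)) ≤ n.natAbs := not_lt.1 hn
    have hnN : N₀ ≤ n.natAbs := (le_max_left _ _).trans hn'
    have hn2 : 2 ^ (m₀ + 1) ≤ n.natAbs := (le_max_right _ _).trans hn'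
    have hne : n.natAbs ≠ 0 := by
      have : 0 < 2 ^ (m₀ + 1) := by positivity
      omega
    have hm : m₀ + 1 ≤ Nat.log 2 n.natAbs := Nat.le_log_of_pow_le one_lt_two hn2
    have hlow := Nat.pow_log_le_self 2 hne
    have hup := Nat.lt_pow_succ_log_self one_lt_two n.natAbs
    have hEle : E n.natAbs ≤ dyadicBound S K L (Nat.log 2 n.natAbs) :=
      orbitSumBound_le_dyadicBound hS0 hK hδ0 hδ1 (hDK _ hnN) (by omega) hlow hup
    have hal := ham _ (by omega) n hlow
    rw [Real.norm_of_nonneg (mul_nonneg (abs_nonneg _) (hρ n))]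
    calc |a n| * ρ n ≤ (4 / (n : ℝ) ^ 2 * Real.exp (-dyadicBound S K L (Nat.log 2 n.natAbs))) *
          Real.exp (dyadicBound S K L (Nat.log 2 n.natAbs)) := by
          refine mul_le_mul hal (Real.exp_le_exp.2 hEle) (hρ n) (by positivity)
      _ = 4 * (1 / (n : ℝ) ^ 2) := by
          rw [mul_assoc, ← Real.exp_add, neg_add_cancel, Real.exp_zero]; ring
  -- `a` and `ρ` do not depend on `A`: the bounds hold on the whole avoiding set. So `Φ` can be
  -- fixed first and `A` shrunk afterwards.
  obtain ⟨Φ, htail, hΦ0⟩ := (((tendsto_tsum_compl_atTop_zero fun n => |a n| * ρ n).eventually_lt_const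
    (abs_pos.2 ha0)).and (Filter.eventually_ge_atTop ({0} : Finset ℤ))).exists
  obtain ⟨A, hAB, hAm, hμA, hAΦ⟩ := exists_wandering_subset (fun n => (hmp n).measurable) hBm hB
    (fun x hx n hn => zpow_apply_ne_of_mapDiscrepancy_tendsto hD0
      (lt_of_le_of_ne x.2.2 (by simpa using (hx 0).1)) hn) Φ
  have hr : ((Real.exp κ : ℝ) : ℂ) ≠ 0 := by exact_mod_cast (Real.exp_pos κ).ne'
  have hlog : ∀ x ∈ A, ∀ k : ℤ, Real.log ‖v ((σ ^ k) x) / ((Real.exp κ : ℝ) : ℂ)‖ =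
      Real.log ‖v ((σ ^ k) x)‖ - κ := by
    intro x hx k
    have hx' : OrbitAvoids σ c δ x := hAB hx
    rw [norm_div, Complex.norm_real, Real.norm_of_nonneg (Real.exp_pos κ).le,
      Real.log_div (norm_ne_zero_iff.2 (hx'.ne_zero hC hvn hδ0 k)) (Real.exp_pos κ).ne',
      Real.log_exp]
  refine hasNontrivialHyperinvariantSubspace_of_wandering hσ hσ' hvm hT hr hAm hμA
    (fun x hx => OrbitAvoids.ne_zero hC hvn hδ0 (hAB hx)) hρ ?_ ?_ hsum
    (hΦ0 (Finset.mem_singleton_self 0)) hAΦ htail hconv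
  · intro x hx n
    have hx' : OrbitAvoids σ c δ x := hAB hx
    refine norm_cocycle_le (fun k => div_ne_zero (hx'.ne_zero hC hvn hδ0 _) hr) ?_ ?_ n
    · intro N
      simp_rw [hlog x hx]
      have := hx'.abs_sum_range_neg_le hC hs hvn hδ0 hδ1 N
      simpa only [neg_add'] using this
    · intro N
      simp_rw [hlog x hx]
      have := hx'.abs_sum_range_le hC hs hvn hδ0 hδ1 N
      have e : ∀ k : ℕ, -(-((k : ℤ) + 1)) - 1 = k := fun k => by ring
      simpa only [e] using this
  · intro x hx n
    have hx' : OrbitAvoids σ c δ x := hAB hx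
    refine norm_cocycle_le (fun k => div_ne_zero (hx'.ne_zero hC hvn hδ0 _) hr) ?_ ?_ n
    · intro N
      simp_rw [hlog x hx]
      exact hx'.abs_sum_range_le hC hs hvn hδ0 hδ1 N
    · intro N
      simp_rw [hlog x hx]
      exact hx'.abs_sum_range_neg_le hC hs hvn hδ0 hδ1 N
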